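/- Let $v(x)=\sum_n v_nx^n$ be a power series with nonnegative real coefficients and radius of convergence $R\in(0,\infty]$, which is aperiodic, i.e. cannot be written as $x^b g(x^d)$ with a power series $g$ and an integer $d>1$. Let $\phi$ be a power series with complex coefficients and radius of convergence at least $R$, and let $(a_{rs})_{r,s\ge 0}$ be the generalized Riordan array determined by $(v,\phi)$, i.e. $$\sum_{r,s\ge 0}a_{rs}x^ry^s=\frac{\phi(x)}{1-y\,v(x)}.$$ Put $\mu(v;x)=\frac{xv'(x)}{v(x)}$ and $\sigma^2(v;x)=\frac{x^2v''(x)}{v(x)}+\mu(v;x)-\mu(v;x)^2$ for $0<x<R$. Then: 1. The one-sided limits $A=\lim_{x\downarrow 0}\mu(v;x)\in\mathbb R$ and $B=\lim_{x\uparrow R}\mu(v;x)\in(-\infty,\infty]$ exist, and for every real $\lambda$ with $A<\lambda<B$ there is a unique $x=x(\lambda)\in(0,R)$ with $\mu(v;x)=\lambda$. 2. There are functions $b_k:(A,B)\to\mathbb C$, $k\ge 0$, such that for $A<r/s<B$, with $x=x(r/s)$, $$a_{rs}\sim v(x)^s x^{-r}s^{-1/2}\sum_{k=0}^{\infty}b_k(r/s)\,s^{-k}$$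 as an asymptotic expansion as $s\to\infty$, uniformly for $r/s$ in compact subsets of $(A,B)$: for every compact $K\subset(A,B)$ and every $N\ge 0$ there is a constant $M$ such that for all $r\ge 0$, $s\ge 1$ with $r/s\in K$, $$\Bigl|a_{rs}-v(x)^sx^{-r}s^{-1/2}\sum_{k<N}b_k(r/s)s^{-k}\Bigr|\le M\,v(x)^sx^{-r}s^{-1/2-N}.$$ 3. For $A<\lambda<B$ and $x=x(\lambda)$ we have $\sigma^2(v;x)>0$ and $b_0(\lambda)=\dfrac{\phi(x)}{\sqrt{2\pi\sigma^2(v;x)}}$; thus $b_0(\lambda)\ne 0$ if and only if $\phi(x)\neq 0$. 4. $a_{rs}=0$ whenever $s\ge 1$ and $r/s<A$. -/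

import Mathlib

open Filter Topology PowerSeries
open scoped ENNReal

noncomputable section

namespace RiordanAsymp

/-- Radius of convergence of a power series in one variable. -/
def convRadius {𝕜 : Type*} [RCLike 𝕜] (f : 𝕜⟦X⟧) : ℝ≥0∞ :=
  (FormalMultilinearSeries.ofScalars 𝕜 (fun n => coeff n f)).radius

/-- The sum `f(z) = ∑ fₙ zⁿ` of a power series; it is only used inside the disc of convergence. -/
def evalAt {𝕜 : Type*} [RCLike 𝕜] (f : 𝕜⟦X⟧) (z : 𝕜) : 𝕜 :=
  ∑' n : ℕ, coeff n f * z ^ n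

/-- `f` is aperiodic: it cannot be written as `x ^ b * g (x ^ d)` with a power series `g`
and `d > 1`. -/
def IsAperiodic {R : Type*} [CommRing R] (f : R⟦X⟧) : Prop :=
  ¬ ∃ (b d : ℕ) (g : R⟦X⟧), 1 < d ∧ f = X ^ b * g.subst (X ^ d : R⟦X⟧)

/-- The generating function `∑ a r s * x ^ r * y ^ s` of a doubly indexed array, as a power series
in `y` whose coefficients are power series in `x`. -/
def arrayGF (a : ℕ → ℕ → ℂ) : (ℂ⟦X⟧)⟦X⟧ :=
  PowerSeries.mk fun s => PowerSeries.mk fun r => a r s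

/-- `a` is the generalized Riordan array determined by `(v, φ)`: its generating function `F(x, y)`
is `φ(x) / (1 - y v(x))`, that is, `F(x, y) * (1 - y v(x)) = φ(x)`. -/
def IsGeneralizedRiordanArray (v φ : ℂ⟦X⟧) (a : ℕ → ℕ → ℂ) : Prop :=
  arrayGF a * (1 - (X : (ℂ⟦X⟧)⟦X⟧) * C v) = C φ

/-- `μ(v; x) = x v'(x) / v(x)`. -/
def mu (v : ℝ⟦X⟧) (x : ℝ) : ℝ :=
  x * deriv (evalAt v) x / evalAt v x

/-- `σ²(v; x) = x² v''(x) / v(x) + μ(v; x) - μ(v; x)²`. -/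
def sigmaSq (v : ℝ⟦X⟧) (x : ℝ) : ℝ :=
  x ^ 2 * deriv (deriv (evalAt v)) x / evalAt v x + mu v x - mu v x ^ 2

/-- The filter of real `x` tending to `R` from below; it is `atTop` for `R = ∞`. -/
def toLeftOf (R : ℝ≥0∞) : Filter ℝ :=
  comap ENNReal.ofReal (𝓝[<] R)

/-- `x` is a positive real solution of `μ(v; x) = lam` inside the disc of convergence of `v`. -/
def IsSaddle (v : ℝ⟦X⟧) (lam x : ℝ) : Prop :=
  0 < x ∧ ENNReal.ofReal x < convRadius v ∧ mu v x = lam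

/-- The scale `v(x)^s * x^(-r) * s^(-1/2)`. -/
def scale (v : ℝ⟦X⟧) (x : ℝ) (r s : ℕ) : ℝ :=
  evalAt v x ^ s * x ^ (-(r : ℤ)) * (s : ℝ) ^ (-(1 / 2 : ℝ))

end RiordanAsymp

end

/-! Comparing powers of y gives a_{rs} = [x^r] φ v^s (`riordan_coeff`), and Cauchy's formula on the
circle of radius x writes this as x^{-r}/(2π) times the integral of φ(xe^{iθ}) v(xe^{iθ})^s e^{-irθ}
over [-π, π].

The weights v_n x^n / v(x) form a probability distribution on the exponents n, with mean μ(v; x) and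
variance σ²(v; x). Aperiodicity keeps it from concentrating at one point, so σ² > 0 (`sigmaSq_pos`).
Since x μ' = σ², the mean is strictly increasing, whence the limits A, B and the unique saddle
point. Choosing x with μ(v; x) = r/s cancels the linear term of the phase.

Away from θ = 0, aperiodicity also forces |v(xe^{iθ})| < v(x) (`norm_evalAt_lt`), and compactness
turns this into a factor κ < 1, so that part of the circle is exponentially negligible
(`exists_minor_arc_bound`). Near θ = 0 one has v(xe^{iθ})^s e^{-irθ} = v(x)^s exp(-s θ² q(θ)), with
q holomorphic, q(0) = σ²/2 and Re q bounded below by a positive constant. Put θ = w/√s and expand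
G(z) exp(-w² q(z)) in z = w/√s with w frozen: odd terms integrate to 0, and even terms produce the
powers s^{-k} (`norm_laplace_integral_sub_le`).

The error there depends only on a disc radius, a bound for φ and the lower bound for Re q. These are
chosen simultaneously for all x in a compact set (`exists_uniform_saddle_data`), which yields
uniformity in r/s. Finally A is the order p of v, and X^{ps} divides φ v^s, which gives the
vanishing below A. -/

noncomputable section

namespace RiordanAsymp

/-! ### Convergence and termwise differentiation of power series. -/

variable {𝕜 : Type*} [RCLike 𝕜]

theorem summable_norm_coeff_mul_pow {f : 𝕜⟦X⟧} {r : ℝ} (hr : 0 ≤ r)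
    (h : ENNReal.ofReal r < convRadius f) : Summable fun n => ‖coeff n f‖ * r ^ n := by
  have := FormalMultilinearSeries.summable_norm_mul_pow
    (FormalMultilinearSeries.ofScalars 𝕜 (fun n => coeff n f)) (r := r.toNNReal) h
  simpa [FormalMultilinearSeries.ofScalars_norm, hr] using this

theorem le_convRadius_of_summable {f : 𝕜⟦X⟧} {r : ℝ} (hr : 0 ≤ r)
    (h : Summable fun n => ‖coeff n f‖ * r ^ n) : ENNReal.ofReal r ≤ convRadius f := by
  refine FormalMultilinearSeries.le_radius_of_summable_norm _ ?_
  simpa [FormalMultilinearSeries.ofScalars_norm, hr] using h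

theorem le_convRadius_of_forall {f : 𝕜⟦X⟧} {R : ℝ≥0∞}
    (h : ∀ r : ℝ, 0 ≤ r → ENNReal.ofReal r < R → Summable fun n => ‖coeff n f‖ * r ^ n) :
    R ≤ convRadius f := by
  refine ENNReal.le_of_forall_nnreal_lt fun r hr => ?_
  have := le_convRadius_of_summable r.2 (h r r.2 (by simpa using hr))
  simpa using this

/-- The Euler operator `x d/dx`. -/
def euler (f : 𝕜⟦X⟧) : 𝕜⟦X⟧ := PowerSeries.mk fun n => (n : 𝕜) * coeff n f

@[simp] theorem coeff_euler (f : 𝕜⟦X⟧) (n : ℕ) : coeff n (euler f) = (n : 𝕜) * coeff n f := by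
  simp [euler]

theorem exists_between_radius {z : ℝ} (hz : 0 ≤ z) {R : ℝ≥0∞} (h : ENNReal.ofReal z < R) :
    ∃ r : ℝ, z < r ∧ ENNReal.ofReal r < R := by
  obtain ⟨r, h1, h2⟩ := ENNReal.lt_iff_exists_nnreal_btwn.1 h
  refine ⟨r, ?_, by simpa using h2⟩
  rw [ENNReal.ofReal, ENNReal.coe_lt_coe] at h1
  have := NNReal.coe_lt_coe.2 h1
  simpa [hz] using this

/-- At a slightly larger radius t the terms ‖f_n‖ t^n stay bounded, so the series is dominated by a
multiple of ∑ n (r/t)^n. -/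
theorem summable_nat_mul_norm_coeff {f : 𝕜⟦X⟧} {r : ℝ} (hr : 0 ≤ r)
    (h : ENNReal.ofReal r < convRadius f) : Summable fun n : ℕ => (n : ℝ) * ‖coeff n f‖ * r ^ n := by
  obtain ⟨t, hrt, ht⟩ := exists_between_radius hr h
  have ht0 : 0 < t := hr.trans_lt hrt
  have h1 := summable_norm_coeff_mul_pow ht0.le ht
  obtain ⟨C, hC⟩ : ∃ C, ∀ n : ℕ, ‖coeff n f‖ * t ^ n ≤ C := by
    obtain ⟨C, hC⟩ := h1.tendsto_atTop_zero.bddAbove_range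
    exact ⟨C, fun n => hC ⟨n, rfl⟩⟩
  have h2 : Summable fun n : ℕ => ((n : ℝ) ^ 1) * (r / t) ^ n :=
    summable_pow_mul_geometric_of_norm_lt_one 1 (by
      rw [Real.norm_of_nonneg (by positivity)]; exact (div_lt_one ht0).2 hrt)
  refine Summable.of_nonneg_of_le (fun n => by positivity) (fun n => ?_) (h2.mul_left C)
  have : r ^ n = (r / t) ^ n * t ^ n := by rw [div_pow]; field_simp
  calc (n : ℝ) * ‖coeff n f‖ * r ^ n = (‖coeff n f‖ * t ^ n) * ((n : ℝ) ^ 1 * (r / t) ^ n) := by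
        rw [this]; ring
    _ ≤ _ := by gcongr; exact hC n

theorem convRadius_le_euler (f : 𝕜⟦X⟧) : convRadius f ≤ convRadius (euler f) :=
  le_convRadius_of_forall fun r hr h => by
    simpa using summable_nat_mul_norm_coeff hr h

theorem summable_coeff_mul_pow {f : 𝕜⟦X⟧} {z : 𝕜} (h : ENNReal.ofReal ‖z‖ < convRadius f) :
    Summable fun n => coeff n f * z ^ n := by
  refine Summable.of_norm ?_
  simpa using summable_norm_coeff_mul_pow (norm_nonneg z) h

/-- Writing the derivative through the Euler operator keeps later moment computations free of index
shifts, at the price of dividing by z. -/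
theorem hasDerivAt_evalAt {f : 𝕜⟦X⟧} {z : 𝕜} (hz : z ≠ 0)
    (h : ENNReal.ofReal ‖z‖ < convRadius f) :
    HasDerivAt (evalAt f) (evalAt (euler f) z / z) z := by
  obtain ⟨r, hzr, hr⟩ := exists_between_radius (norm_nonneg z) h
  have hr0 : 0 < r := (norm_nonneg z).trans_lt hzr
  have hu : Summable fun n : ℕ => (n : ℝ) * ‖coeff n f‖ * r ^ n / r :=
    (summable_nat_mul_norm_coeff hr0.le hr).div_const r
  have key := hasDerivAt_tsum_of_isPreconnected (𝕜 := 𝕜) (F := 𝕜) (t := Metric.ball 0 r)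
    (g := fun n y => coeff n f * y ^ n) (g' := fun n y => coeff n f * ((n : 𝕜) * y ^ (n - 1)))
    (y₀ := z) (y := z) hu Metric.isOpen_ball (convex_ball _ _).isPreconnected
    (fun n y _ => (hasDerivAt_pow n y).const_mul _) ?_ (by simpa using hzr)
    (summable_coeff_mul_pow h) (by simpa using hzr)
  · suffices h : evalAt (euler f) z / z = ∑' n : ℕ, coeff n f * ((n : 𝕜) * z ^ (n - 1)) by
      rw [h]; exact key
    rw [evalAt, ← tsum_div_const]
    refine tsum_congr fun n => ?_
    rcases n with _ | n
    · simp
    · simp only [coeff_euler, Nat.add_sub_cancel, pow_succ]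
      field_simp
  · intro n y hy
    have hy' : ‖y‖ ≤ r := by simpa using (Metric.mem_ball.1 hy).le
    rcases n with _ | n
    · simp
    · have h1 : ((n + 1 : ℕ) : ℝ) * ‖coeff (n + 1) f‖ * r ^ (n + 1) / r
          = ((n + 1 : ℕ) : ℝ) * ‖coeff (n + 1) f‖ * r ^ n := by
        rw [pow_succ]; field_simp
      rw [h1, norm_mul, norm_mul, norm_pow, RCLike.norm_natCast, Nat.add_sub_cancel]
      calc ‖coeff (n + 1) f‖ * (((n + 1 : ℕ) : ℝ) * ‖y‖ ^ n)
          = ((n + 1 : ℕ) : ℝ) * ‖coeff (n + 1) f‖ * ‖y‖ ^ n := by ring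
        _ ≤ _ := by gcongr

theorem convRadius_map (v : ℝ⟦X⟧) :
    convRadius (PowerSeries.map Complex.ofRealHom v) = convRadius v := by
  refine le_antisymm (le_convRadius_of_forall fun r hr h => ?_)
    (le_convRadius_of_forall fun r hr h => ?_) <;>
  simpa using summable_norm_coeff_mul_pow hr h

theorem euler_map (v : ℝ⟦X⟧) :
    euler (PowerSeries.map Complex.ofRealHom v) = PowerSeries.map Complex.ofRealHom (euler v) := by
  ext n; simp

theorem evalAt_map_ofReal (v : ℝ⟦X⟧) (x : ℝ) :
    evalAt (PowerSeries.map Complex.ofRealHom v) (x : ℂ) = ((evalAt v x : ℝ) : ℂ) := by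
  simp [evalAt, Complex.ofReal_tsum]

/-! ### Products of series, the array as coefficients of φ v^s, and Cauchy's formula. -/

/-- Absolute convergence of a power series on the circle of radius `r`. -/
def AbsConvAt (f : 𝕜⟦X⟧) (r : ℝ) : Prop := Summable fun n => ‖coeff n f‖ * r ^ n

theorem AbsConvAt.mul_and_eval {f g : 𝕜⟦X⟧} {r : ℝ} (hr : 0 ≤ r) (hf : AbsConvAt f r)
    (hg : AbsConvAt g r) :
    AbsConvAt (f * g) r ∧ ∀ z : 𝕜, ‖z‖ = r → evalAt (f * g) z = evalAt f z * evalAt g z := by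
  have hcoef : ∀ (z : 𝕜) (n : ℕ), coeff n (f * g) * z ^ n =
      ∑ kl ∈ Finset.HasAntidiagonal.antidiagonal n, (coeff kl.1 f * z ^ kl.1) * (coeff kl.2 g * z ^ kl.2) := by
    intro z n
    rw [coeff_mul, Finset.sum_mul]
    refine Finset.sum_congr rfl fun kl hkl => ?_
    rw [← Finset.HasAntidiagonal.mem_antidiagonal.1 hkl, pow_add]; ring
  have hn : ∀ (z : 𝕜) (f : 𝕜⟦X⟧), ‖z‖ = r → AbsConvAt f r →
      Summable fun n => ‖coeff n f * z ^ n‖ := by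
    intro z f hz hf
    simpa [hz, AbsConvAt] using hf
  constructor
  · have hz : ‖(r : 𝕜)‖ = r := by simp [hr]
    have := summable_norm_sum_mul_antidiagonal_of_summable_norm (hn _ f hz hf) (hn _ g hz hg)
    simp_rw [← hcoef, norm_mul, norm_pow, hz] at this
    exact this
  · intro z hz
    rw [evalAt, evalAt, evalAt,
      tsum_mul_tsum_eq_tsum_sum_antidiagonal_of_summable_norm (hn _ f hz hf) (hn _ g hz hg)]
    exact tsum_congr (hcoef z)

theorem AbsConvAt.pow_and_eval {f : 𝕜⟦X⟧} {r : ℝ} (hr : 0 ≤ r) (hf : AbsConvAt f r) (s : ℕ) :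
    AbsConvAt (f ^ s) r ∧ ∀ z : 𝕜, ‖z‖ = r → evalAt (f ^ s) z = evalAt f z ^ s := by
  induction s with
  | zero =>
    constructor
    · refine summable_of_ne_finset_zero (s := {0}) fun n hn => ?_
      have : n ≠ 0 := by simpa using hn
      simp [coeff_one, this]
    · intro z _
      rw [evalAt, tsum_eq_single 0]
      · simp
      · intro n hn
        simp [coeff_one, hn]
  | succ s ih =>
    obtain ⟨h1, h2⟩ := ih
    obtain ⟨h3, h4⟩ := h1.mul_and_eval hr hf
    refine ⟨by rwa [pow_succ], fun z hz => ?_⟩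
    rw [pow_succ, h4 z hz, h2 z hz, pow_succ]

/-- The defining identity reads F = φ + y v F, so the coefficient of y^0 is φ and each further power
of y contributes one factor v. -/
theorem riordan_coeff {v φ : ℂ⟦X⟧} {a : ℕ → ℕ → ℂ} (h : IsGeneralizedRiordanArray v φ a)
    (r s : ℕ) : a r s = coeff r (φ * v ^ s) := by
  have key : ∀ s, (PowerSeries.mk fun r => a r s : ℂ⟦X⟧) = φ * v ^ s := by
    intro s
    have hF : ∀ s, coeff s (arrayGF a) = (PowerSeries.mk fun r => a r s : ℂ⟦X⟧) := by
      intro s; simp [arrayGF]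
    have h' : arrayGF a = C φ + X * (arrayGF a * C v) := by
      rw [← h]; ring
    induction s with
    | zero =>
      rw [← hF, h']; simp
    | succ s ih =>
      rw [← hF, h', map_add, coeff_succ_X_mul, coeff_mul_C, hF, ih]
      simp [pow_succ, mul_assoc]
  have := congrArg (coeff r) (key s)
  simpa using this

/-- Cauchy's formula for the coefficients of an absolutely convergent power series. -/
theorem coeff_eq_integral {f : ℂ⟦X⟧} {x : ℝ} (hx : 0 < x) (hf : AbsConvAt f x) (r : ℕ) :
    coeff r f = (1 / (2 * Real.pi) : ℝ) * (x : ℂ) ^ (-(r : ℤ)) *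
      ∫ θ in (-Real.pi)..Real.pi, evalAt f (x * Complex.exp (Complex.I * θ)) *
        Complex.exp (-(Complex.I * r * θ)) := by
  have hxc : (x : ℂ) ≠ 0 := by exact_mod_cast hx.ne'
  set F : ℕ → C(ℝ, ℂ) := fun n => ⟨fun θ => coeff n f * (x * Complex.exp (Complex.I * θ)) ^ n *
        Complex.exp (-(Complex.I * r * θ)), by fun_prop⟩ with hF
  have hnorm : ∀ n (θ : ℝ), ‖F n θ‖ = ‖coeff n f‖ * x ^ n := by
    intro n θ
    have h1 : ‖Complex.exp (Complex.I * θ)‖ = 1 := by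
      rw [mul_comm]; exact Complex.norm_exp_ofReal_mul_I θ
    have h2 : ‖Complex.exp (-(Complex.I * r * θ))‖ = 1 := by
      have := Complex.norm_exp_ofReal_mul_I (-(r * θ))
      rw [← this]; congr 2; push_cast; ring
    simp [hF, h1, h2, abs_of_pos hx]
  have key := intervalIntegral.hasSum_intervalIntegral_of_summable_norm (a := -Real.pi) (b := Real.pi)
    (f := F) (by
      refine Summable.of_nonneg_of_le (fun n => norm_nonneg _) (fun n => ?_) hf
      refine (ContinuousMap.norm_le _ (by positivity)).2 fun θ => ?_
      exact (hnorm n θ).le)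
  have hterm : ∀ n, ∫ θ in (-Real.pi)..Real.pi, F n θ =
      if n = r then coeff r f * x ^ r * (2 * Real.pi) else 0 := by
    intro n
    have hFn : ∀ θ : ℝ, F n θ = coeff n f * x ^ n * Complex.exp ((Complex.I * (n - r)) * θ) := by
      intro θ
      simp only [hF, ContinuousMap.coe_mk, mul_pow, ← Complex.exp_nat_mul]
      rw [mul_assoc, mul_assoc, ← Complex.exp_add, ← mul_assoc]
      congr 2; ring
    simp_rw [hFn, intervalIntegral.integral_const_mul]
    split_ifs with h
    · subst h; simp; left; ring
    · have hnr : (n : ℂ) - r ≠ 0 := by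
        rw [sub_ne_zero]; exact_mod_cast h
      have hc : Complex.I * ((n : ℂ) - r) ≠ 0 := mul_ne_zero Complex.I_ne_zero hnr
      rw [integral_exp_mul_complex hc]
      have : Complex.exp (Complex.I * (n - r) * (Real.pi : ℝ)) =
          Complex.exp (Complex.I * (n - r) * ((-Real.pi : ℝ) : ℂ)) := by
        rw [Complex.exp_eq_exp_iff_exists_int]
        refine ⟨(n : ℤ) - r, ?_⟩
        push_cast; ring
      rw [this]; simp
  have hint : ∫ θ in (-Real.pi)..Real.pi, evalAt f (x * Complex.exp (Complex.I * θ)) *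
        Complex.exp (-(Complex.I * r * θ)) = coeff r f * x ^ r * (2 * Real.pi) := by
    have h1 := key.tsum_eq
    simp_rw [hterm] at h1
    rw [tsum_ite_eq] at h1
    rw [h1]
    refine intervalIntegral.integral_congr fun θ _ => ?_
    simp only [evalAt, hF, ContinuousMap.coe_mk]
    rw [tsum_mul_right]
  rw [hint]
  have hpi : (Real.pi : ℂ) ≠ 0 := by exact_mod_cast Real.pi_ne_zero
  simp only [zpow_neg, zpow_natCast]
  push_cast
  field_simp

/-! ### Taylor remainders and Laplace's method. -/

/-- The `k`-th Taylor coefficient of `f` at the origin. -/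
def taylorCoeff (f : ℂ → ℂ) (k : ℕ) : ℂ := (k.factorial : ℂ)⁻¹ * iteratedDeriv k f 0

theorem norm_taylorCoeff_le {f : ℂ → ℂ} {ρ C : ℝ} (hρ : 0 < ρ)
    (hf : DifferentiableOn ℂ f (Metric.closedBall 0 ρ))
    (hC : ∀ z : ℂ, ‖z‖ ≤ ρ → ‖f z‖ ≤ C) (k : ℕ) : ‖taylorCoeff f k‖ ≤ C / ρ ^ k := by
  have h := Complex.norm_iteratedDeriv_le_of_forall_mem_sphere_norm_le k hρ
    (hf.diffContOnCl_ball subset_rfl) (fun z hz => hC z (by simpa using hz.le))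
  have hk : (0 : ℝ) < k.factorial := by positivity
  rw [taylorCoeff, norm_mul, norm_inv, Complex.norm_natCast, inv_mul_le_iff₀ hk]
  rwa [mul_div_assoc] at h

/-- By Cauchy's estimates the tail is dominated by a geometric series of ratio ‖z‖/ρ ≤ 1/2; its sum
accounts for the factor 2. -/
theorem norm_sub_taylor_le {f : ℂ → ℂ} {ρ C : ℝ} (hρ : 0 < ρ)
    (hf : DifferentiableOn ℂ f (Metric.closedBall 0 ρ))
    (hC : ∀ z : ℂ, ‖z‖ ≤ ρ → ‖f z‖ ≤ C) (n : ℕ) {z : ℂ} (hz : ‖z‖ ≤ ρ / 2) :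
    ‖f z - ∑ k ∈ Finset.range n, taylorCoeff f k * z ^ k‖ ≤ 2 * C * (‖z‖ / ρ) ^ n := by
  have hC0 : 0 ≤ C := (norm_nonneg _).trans (hC 0 (by simpa using hρ.le))
  have hz' : z ∈ Metric.ball (0 : ℂ) ρ := by
    rw [mem_ball_zero_iff]; linarith
  have hs := Complex.hasSum_taylorSeries_on_ball (hf.mono Metric.ball_subset_closedBall) hz'
  have hs' : HasSum (fun k => taylorCoeff f k * z ^ k) (f z) := by
    refine (funext fun k => ?_ : (fun k => taylorCoeff f k * z ^ k) = _) ▸ hs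
    simp only [taylorCoeff, sub_zero, smul_eq_mul]; ring
  have ht := (hasSum_nat_add_iff' n).2 hs'
  have hg : HasSum (fun k : ℕ => C * (‖z‖ / ρ) ^ n * (1 / 2 : ℝ) ^ k)
      (C * (‖z‖ / ρ) ^ n * 2) := by
    simpa using hasSum_geometric_two.mul_left (C * (‖z‖ / ρ) ^ n)
  refine (ht.norm_le_of_bounded hg fun k => ?_).trans_eq (by ring)
  have hq : ‖z‖ / ρ ≤ 1 / 2 := by rw [div_le_iff₀ hρ]; linarith
  calc ‖taylorCoeff f (k + n) * z ^ (k + n)‖ ≤ C / ρ ^ (k + n) * ‖z‖ ^ (k + n) := by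
        rw [norm_mul, norm_pow]
        gcongr
        exact norm_taylorCoeff_le hρ hf hC _
    _ = C * (‖z‖ / ρ) ^ n * (‖z‖ / ρ) ^ k := by rw [pow_add, pow_add, div_pow, div_pow]; field_simp
    _ ≤ _ := by gcongr

/-- The integral form shows continuous dependence on the parameter w of `laplaceFun`, which is
needed for measurability. -/
theorem taylorCoeff_eq_circleIntegral {f : ℂ → ℂ} {ρ : ℝ} (hρ : 0 < ρ)
    (hf : DifferentiableOn ℂ f (Metric.closedBall 0 ρ)) (k : ℕ) :
    taylorCoeff f k = (2 * Real.pi * Complex.I)⁻¹ * ∮ z in C(0, ρ), (z⁻¹ ^ (k + 1)) * f z := by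
  have h := (hf.diffContOnCl_ball subset_rfl).circleIntegral_one_div_sub_center_pow_smul hρ k
  have hk : (k.factorial : ℂ) ≠ 0 := by exact_mod_cast k.factorial_ne_zero
  simp only [sub_zero, one_div, smul_eq_mul] at h
  simp only [inv_pow, h, taylorCoeff]
  have : (2 * Real.pi * Complex.I) ≠ 0 := Complex.two_pi_I_ne_zero
  field_simp

/-- The integrand `G(z) exp(-w² q(z))` after rescaling. -/
def laplaceFun (G q : ℂ → ℂ) (w : ℝ) (z : ℂ) : ℂ := G z * Complex.exp (-((w : ℂ) ^ 2 * q z))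

/-- The `j`-th coefficient in the asymptotic expansion of `∫ G(u) exp(-s u² q(u)) du`. -/
def laplaceCoeff (G q : ℂ → ℂ) (j : ℕ) : ℂ :=
  ∫ w : ℝ, taylorCoeff (laplaceFun G q w) (2 * j) * (w : ℂ) ^ (2 * j)

section Laplace

variable {G q : ℂ → ℂ} {ρ C c : ℝ} (hρ : 0 < ρ)
  (hG : DifferentiableOn ℂ G (Metric.closedBall 0 ρ))
  (hq : DifferentiableOn ℂ q (Metric.closedBall 0 ρ))
  (hGC : ∀ z : ℂ, ‖z‖ ≤ ρ → ‖G z‖ ≤ C) (hqc : ∀ z : ℂ, ‖z‖ ≤ ρ → c ≤ (q z).re)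

theorem differentiableOn_laplaceFun {U : Set ℂ} (hG : DifferentiableOn ℂ G U)
    (hq : DifferentiableOn ℂ q U) (w : ℝ) : DifferentiableOn ℂ (laplaceFun G q w) U :=
  hG.mul (hq.const_mul _).neg.cexp

theorem norm_laplaceFun_le (hGC : ∀ z : ℂ, ‖z‖ ≤ ρ → ‖G z‖ ≤ C)
    (hqc : ∀ z : ℂ, ‖z‖ ≤ ρ → c ≤ (q z).re) (w : ℝ) (z : ℂ) (hz : ‖z‖ ≤ ρ) :
    ‖laplaceFun G q w z‖ ≤ C * Real.exp (-c * w ^ 2) := by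
  have hC0 : 0 ≤ C := (norm_nonneg _).trans (hGC z hz)
  have hre : (-((w : ℂ) ^ 2 * q z)).re = -(w ^ 2 * (q z).re) := by
    rw [← Complex.ofReal_pow, Complex.neg_re, Complex.re_ofReal_mul]
  rw [laplaceFun, norm_mul, Complex.norm_exp, hre]
  have := hqc z hz
  gcongr
  · exact hGC z hz
  · nlinarith [sq_nonneg w]

include hρ hG hq in
theorem continuous_taylorCoeff_laplaceFun (k : ℕ) :
    Continuous fun w : ℝ => taylorCoeff (laplaceFun G q w) k := by
  have h : ∀ w : ℝ, taylorCoeff (laplaceFun G q w) k = _ := fun w =>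
    taylorCoeff_eq_circleIntegral hρ (differentiableOn_laplaceFun hG hq w) k
  simp_rw [h, circleIntegral]
  have hmem : ∀ θ, circleMap 0 ρ θ ∈ Metric.closedBall (0 : ℂ) ρ := fun θ =>
    circleMap_mem_closedBall 0 hρ.le θ
  have hG' : Continuous fun θ => G (circleMap 0 ρ θ) :=
    hG.continuousOn.comp_continuous (continuous_circleMap 0 ρ) hmem
  have hq' : Continuous fun θ => q (circleMap 0 ρ θ) :=
    hq.continuousOn.comp_continuous (continuous_circleMap 0 ρ) hmem
  have hinv : Continuous fun θ => (circleMap 0 ρ θ)⁻¹ :=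
    (continuous_circleMap 0 ρ).inv₀ fun θ => circleMap_ne_center hρ.ne'
  refine continuous_const.mul
    (intervalIntegral.continuous_parametric_intervalIntegral_of_continuous' ?_ _ _)
  simp only [laplaceFun, deriv_circleMap, smul_eq_mul, Function.uncurry_def]
  have h1 := hG'.comp (continuous_snd (X := ℝ) (Y := ℝ))
  have h2 := hq'.comp (continuous_snd (X := ℝ) (Y := ℝ))
  have h3 := hinv.comp (continuous_snd (X := ℝ) (Y := ℝ))
  have h4 := (continuous_circleMap 0 ρ).comp (continuous_snd (X := ℝ) (Y := ℝ))
  simp only [Function.comp_def] at h1 h2 h3 h4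
  exact (h4.mul continuous_const).mul ((h3.pow _).mul (h1.mul ((((by fun_prop : Continuous fun p : ℝ × ℝ =>
    (p.1 : ℂ) ^ 2).mul h2).neg).cexp)))

theorem integrable_abs_pow_mul_gaussian (hc : 0 < c) (k : ℕ) :
    MeasureTheory.Integrable fun w : ℝ => |w| ^ k * Real.exp (-c * w ^ 2) := by
  have h := (integrable_rpow_mul_exp_neg_mul_sq hc (s := k) (by
    have : (0 : ℝ) ≤ k := by positivity
    linarith)).norm
  refine h.congr (Eventually.of_forall fun w => ?_)
  simp [Real.rpow_natCast]

include hρ hG hq hGC hqc in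
theorem norm_taylorCoeff_laplaceFun_le (w : ℝ) (k : ℕ) :
    ‖taylorCoeff (laplaceFun G q w) k‖ ≤ C * Real.exp (-c * w ^ 2) / ρ ^ k :=
  norm_taylorCoeff_le hρ (differentiableOn_laplaceFun hG hq w)
    (fun z hz => norm_laplaceFun_le hGC hqc w z hz) k

include hρ hG hq hGC hqc in
theorem integrable_taylorCoeff_mul_pow (hc : 0 < c) (k : ℕ) :
    MeasureTheory.Integrable fun w : ℝ => taylorCoeff (laplaceFun G q w) k * (w : ℂ) ^ k := by
  refine ((integrable_abs_pow_mul_gaussian hc k).const_mul (C / ρ ^ k)).mono' ?_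
    (Eventually.of_forall fun w => ?_)
  · have := continuous_taylorCoeff_laplaceFun hρ hG hq k
    exact (by fun_prop : Continuous fun w : ℝ =>
      taylorCoeff (laplaceFun G q w) k * (w : ℂ) ^ k).aestronglyMeasurable
  · rw [norm_mul, norm_pow, Complex.norm_real, Real.norm_eq_abs]
    calc _ ≤ C * Real.exp (-c * w ^ 2) / ρ ^ k * |w| ^ k := by
          gcongr; exact norm_taylorCoeff_laplaceFun_le hρ hG hq hGC hqc w k
      _ = _ := by ring

/-- `laplaceFun` depends on w only through w², so the integrand is odd in w. -/
theorem integral_taylorCoeff_mul_pow_odd {k : ℕ} (hk : Odd k) :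
    ∫ w : ℝ, taylorCoeff (laplaceFun G q w) k * (w : ℂ) ^ k = 0 := by
  have h := MeasureTheory.integral_neg_eq_self
    (fun w : ℝ => taylorCoeff (laplaceFun G q w) k * (w : ℂ) ^ k) MeasureTheory.volume
  have h2 : ∀ w : ℝ, laplaceFun G q (-w) = laplaceFun G q w := fun w => by
    funext z; simp [laplaceFun]
  simp only [h2, Complex.ofReal_neg, hk.neg_pow, mul_neg, MeasureTheory.integral_neg] at h
  exact self_eq_neg.1 h.symm

include hρ hG hq hGC hqc in
-- One integrable majorant serves both ranges of w. Inside the window it is the Taylor remainder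
-- (the 2 in n + 2). Outside, only the polynomial is left, and there 2|w|/(ρT) ≥ 1, so each of its n
-- terms is bounded by the n-th power (the n in n + 2). Hence the Taylor terms may be integrated
-- over the whole line.
theorem norm_indicator_sub_taylor_le (n : ℕ) {T : ℝ} (hT : 0 < T) (w : ℝ) :
    ‖(Set.Icc (-(ρ / 2 * T)) (ρ / 2 * T)).indicator
        (fun w : ℝ => laplaceFun G q w ((w / T : ℝ) : ℂ)) w -
      ∑ k ∈ Finset.range n, taylorCoeff (laplaceFun G q w) k * ((w / T : ℝ) : ℂ) ^ k‖ ≤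
      (n + 2) * C * (2 / (ρ * T)) ^ n * (|w| ^ n * Real.exp (-c * w ^ 2)) := by
  have hC0 : 0 ≤ C := (norm_nonneg _).trans (hGC 0 (by simpa using hρ.le))
  have hnz : ‖((w / T : ℝ) : ℂ)‖ = |w| / T := by
    rw [Complex.norm_real, Real.norm_eq_abs, abs_div, abs_of_pos hT]
  set E := C * Real.exp (-c * w ^ 2) with hE
  have hE0 : 0 ≤ E := by positivity
  have hrhs : (n + 2) * C * (2 / (ρ * T)) ^ n * (|w| ^ n * Real.exp (-c * w ^ 2)) =
      (n + 2) * E * (2 * (|w| / T) / ρ) ^ n := by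
    rw [hE, show 2 * (|w| / T) / ρ = 2 / (ρ * T) * |w| by field_simp, mul_pow]; ring
  rw [hrhs]
  by_cases hw : w ∈ Set.Icc (-(ρ / 2 * T)) (ρ / 2 * T)
  · have hwT : |w| / T ≤ ρ / 2 := by
      rw [div_le_iff₀ hT]; exact abs_le.2 hw
    rw [Set.indicator_of_mem hw]
    refine (norm_sub_taylor_le hρ (differentiableOn_laplaceFun hG hq w)
      (fun z hz => norm_laplaceFun_le hGC hqc w z hz) n (hnz.trans_le hwT)).trans ?_
    rw [hnz, ← hE]
    have : (|w| / T / ρ) ^ n ≤ (2 * (|w| / T) / ρ) ^ n := by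
      gcongr
      have : 0 ≤ |w| / T := by positivity
      linarith
    calc 2 * E * (|w| / T / ρ) ^ n ≤ (n + 2) * E * (|w| / T / ρ) ^ n := by
          gcongr; linarith [(Nat.cast_nonneg n : (0 : ℝ) ≤ n)]
      _ ≤ _ := by gcongr
  · have hwT : ρ / 2 < |w| / T := by
      rw [lt_div_iff₀ hT]; by_contra h
      exact hw (abs_le.1 (not_lt.1 h))
    rw [Set.indicator_of_notMem hw, zero_sub, norm_neg]
    have h1 : 1 ≤ 2 * (|w| / T) / ρ := by rw [le_div_iff₀ hρ]; linarith
    calc _ ≤ ∑ k ∈ Finset.range n, E * (2 * (|w| / T) / ρ) ^ n := by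
          refine norm_sum_le_of_le _ fun k hk => ?_
          rw [norm_mul, norm_pow, hnz]
          calc _ ≤ E / ρ ^ k * (|w| / T) ^ k := by
                gcongr; exact norm_taylorCoeff_laplaceFun_le hρ hG hq hGC hqc w k
            _ = E * (|w| / T / ρ) ^ k := by rw [div_pow _ ρ]; ring
            _ ≤ E * (2 * (|w| / T) / ρ) ^ k := by
                gcongr
                have : 0 ≤ |w| / T := by positivity
                linarith
            _ ≤ _ := by
                exact mul_le_mul_of_nonneg_left
                  (pow_le_pow_right₀ h1 (Finset.mem_range.1 hk).le) hE0
      _ = n * E * (2 * (|w| / T) / ρ) ^ n := by simp; ring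
      _ ≤ _ := by gcongr; linarith

theorem sum_range_two_mul_of_odd {M : Type*} [AddCommMonoid M] (f : ℕ → M)
    (hf : ∀ k, Odd k → f k = 0) (N : ℕ) :
    ∑ k ∈ Finset.range (2 * N), f k = ∑ j ∈ Finset.range N, f (2 * j) := by
  induction N with
  | zero => simp
  | succ N ih =>
    rw [show 2 * (N + 1) = 2 * N + 1 + 1 by ring, Finset.sum_range_succ, Finset.sum_range_succ, ih,
      Finset.sum_range_succ, hf (2 * N + 1) ⟨N, rfl⟩, add_zero]

include hρ hG hq hGC hqc in
/-- Laplace's method with explicit dependence of the error term on the data. -/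
theorem norm_laplace_integral_sub_le (hc : 0 < c) (N : ℕ) {s : ℝ} (hs : 0 < s) :
    ‖(∫ u in (-(ρ / 2))..(ρ / 2), G u * Complex.exp (-(s * (u : ℂ) ^ 2 * q u))) -
        (√s)⁻¹ * ∑ j ∈ Finset.range N, laplaceCoeff G q j * ((s : ℂ) ^ j)⁻¹‖ ≤
      ((2 * N : ℕ) + 2) * C * (2 / ρ) ^ (2 * N) *
        (∫ w : ℝ, |w| ^ (2 * N) * Real.exp (-c * w ^ 2)) * ((√s)⁻¹ * (s ^ N)⁻¹) := by
  -- The substitution u = w / T turns s u² q(u) into w² q(w / T).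
  set T := √s with hTdef
  have hT : 0 < T := Real.sqrt_pos.2 hs
  have hT2 : T ^ 2 = s := Real.sq_sqrt hs.le
  have hTc : (T : ℂ) ≠ 0 := by exact_mod_cast hT.ne'
  have hsT : (s : ℂ) = (T : ℂ) ^ 2 := by rw [← hT2]; push_cast; rfl
  have hle : -(ρ / 2 * T) ≤ ρ / 2 * T := by nlinarith
  set F : ℝ → ℂ := (Set.Icc (-(ρ / 2 * T)) (ρ / 2 * T)).indicator
        (fun w : ℝ => laplaceFun G q w ((w / T : ℝ) : ℂ)) with hF
  set S : ℝ → ℂ := fun w => ∑ k ∈ Finset.range (2 * N),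
    taylorCoeff (laplaceFun G q w) k * ((w / T : ℝ) : ℂ) ^ k with hS
  have hterm : ∀ (k : ℕ) (w : ℝ), taylorCoeff (laplaceFun G q w) k * ((w / T : ℝ) : ℂ) ^ k =
      taylorCoeff (laplaceFun G q w) k * (w : ℂ) ^ k * ((T : ℂ) ^ k)⁻¹ := by
    intro k w
    rw [Complex.ofReal_div, div_pow, div_eq_mul_inv, mul_assoc]
  have hSint : MeasureTheory.Integrable S := by
    refine MeasureTheory.integrable_finsetSum _ fun k _ => ?_
    simp_rw [hterm]
    exact (integrable_taylorCoeff_mul_pow hρ hG hq hGC hqc hc k).mul_const _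
  have hSval : ∫ w, S w = ∑ j ∈ Finset.range N, laplaceCoeff G q j * ((s : ℂ) ^ j)⁻¹ := by
    rw [hS, MeasureTheory.integral_finsetSum]
    · simp_rw [hterm, MeasureTheory.integral_mul_const]
      -- Of the 2N Taylor terms only the N even ones survive; this is why the expansion runs in
      -- powers of 1/s and not of 1/√s.
      rw [sum_range_two_mul_of_odd]
      · refine Finset.sum_congr rfl fun j _ => ?_
        rw [laplaceCoeff, hsT, ← pow_mul]
      · intro k hk
        rw [integral_taylorCoeff_mul_pow_odd hk, zero_mul]
    · intro k _
      simp_rw [hterm]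
      exact (integrable_taylorCoeff_mul_pow hρ hG hq hGC hqc hc k).mul_const _
  have hmem : ∀ w ∈ Set.Icc (-(ρ / 2 * T)) (ρ / 2 * T),
      ((w / T : ℝ) : ℂ) ∈ Metric.closedBall (0 : ℂ) ρ := by
    intro w hw
    rw [mem_closedBall_zero_iff, Complex.norm_real, Real.norm_eq_abs, abs_div, abs_of_pos hT,
      div_le_iff₀ hT]
    have := abs_le.2 hw
    nlinarith
  have hcont : ContinuousOn (fun w : ℝ => laplaceFun G q w ((w / T : ℝ) : ℂ))
      (Set.Icc (-(ρ / 2 * T)) (ρ / 2 * T)) := by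
    have hdiv : ContinuousOn (fun w : ℝ => ((w / T : ℝ) : ℂ))
      (Set.Icc (-(ρ / 2 * T)) (ρ / 2 * T)) := by fun_prop
    have h1 := hG.continuousOn.comp hdiv hmem
    have h2 := hq.continuousOn.comp hdiv hmem
    simp only [Function.comp_def] at h1 h2
    simp only [laplaceFun]
    exact h1.mul ((((by fun_prop : Continuous fun w : ℝ => (w : ℂ) ^ 2).continuousOn.mul h2).neg).cexp)
  have hFint : MeasureTheory.Integrable F :=
    (MeasureTheory.integrable_indicator_iff measurableSet_Icc).2 hcont.integrableOn_Icc
  have hFval : ∫ w, F w =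
      T * ∫ u in (-(ρ / 2))..(ρ / 2), G u * Complex.exp (-(s * (u : ℂ) ^ 2 * q u)) := by
    rw [hF, MeasureTheory.integral_indicator measurableSet_Icc,
      MeasureTheory.integral_Icc_eq_integral_Ioc, ← intervalIntegral.integral_of_le hle]
    have hsub := intervalIntegral.integral_comp_div
      (a := -(ρ / 2 * T)) (b := ρ / 2 * T)
      (fun u : ℝ => G u * Complex.exp (-(s * (u : ℂ) ^ 2 * q u))) hT.ne'
    rw [neg_div, mul_div_cancel_right₀ _ hT.ne', Complex.real_smul] at hsub
    rw [← hsub]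
    refine intervalIntegral.integral_congr fun w _ => ?_
    simp only [laplaceFun, hsT]
    congr 3
    push_cast
    field_simp
  have hmain : ‖∫ w, (F w - S w)‖ ≤ ∫ w : ℝ, ((2 * N : ℕ) + 2) * C * (2 / (ρ * T)) ^ (2 * N) *
      (|w| ^ (2 * N) * Real.exp (-c * w ^ 2)) :=
    MeasureTheory.norm_integral_le_of_norm_le
      ((integrable_abs_pow_mul_gaussian hc (2 * N)).const_mul _)
      (Eventually.of_forall fun w => norm_indicator_sub_taylor_le hρ hG hq hGC hqc (2 * N) hT w)
  rw [MeasureTheory.integral_sub hFint hSint, hFval, hSval, MeasureTheory.integral_const_mul]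
    at hmain
  have hfac : (∫ u in (-(ρ / 2))..(ρ / 2), G u * Complex.exp (-(s * (u : ℂ) ^ 2 * q u))) -
        (T : ℝ)⁻¹ * ∑ j ∈ Finset.range N, laplaceCoeff G q j * ((s : ℂ) ^ j)⁻¹ =
      (T : ℂ)⁻¹ * (T * (∫ u in (-(ρ / 2))..(ρ / 2), G u * Complex.exp (-(s * (u : ℂ) ^ 2 * q u))) -
        ∑ j ∈ Finset.range N, laplaceCoeff G q j * ((s : ℂ) ^ j)⁻¹) := by
    rw [mul_sub, inv_mul_cancel_left₀ hTc, Complex.ofReal_inv]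
  rw [hfac, norm_mul, norm_inv, Complex.norm_real, Real.norm_of_nonneg hT.le]
  refine (mul_le_mul_of_nonneg_left hmain (by positivity)).trans_eq ?_
  have : (2 / (ρ * T)) ^ (2 * N) = (2 / ρ) ^ (2 * N) * (s ^ N)⁻¹ := by
    rw [← hT2, ← pow_mul, ← div_div, div_pow _ T, div_eq_mul_inv]
  rw [this]; ring

end Laplace

theorem laplaceCoeff_zero (G q : ℂ → ℂ) {b : ℝ} (hq : q 0 = b) :
    laplaceCoeff G q 0 = G 0 * (√(Real.pi / b) : ℝ) := by
  have : ∀ w : ℝ, taylorCoeff (laplaceFun G q w) (2 * 0) * (w : ℂ) ^ (2 * 0) =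
      G 0 * (Real.exp (-b * w ^ 2) : ℝ) := by
    intro w
    simp [taylorCoeff, laplaceFun, hq]
    left; congr 2; ring
  rw [laplaceCoeff]
  simp_rw [this]
  rw [MeasureTheory.integral_const_mul, integral_complex_ofReal, integral_gaussian]

/-! ### Aperiodicity in terms of the support. -/

theorem IsAperiodic.exists_not_dvd {v : ℝ⟦X⟧} (h : IsAperiodic v) (b : ℕ) {d : ℕ} (hd : 1 < d) :
    ∃ n, coeff n v ≠ 0 ∧ ¬ (b ≤ n ∧ d ∣ n - b) := by
  by_contra! hcon
  refine h ⟨b, d, PowerSeries.mk fun k => coeff (b + d * k) v, hd, ?_⟩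
  ext n
  rw [coeff_X_pow_mul', coeff_subst_X_pow (by omega : d ≠ 0)]
  by_cases hn : coeff n v = 0
  · rw [hn]
    split_ifs with h1 h2
    · simp [Nat.mul_div_cancel' h2, Nat.add_sub_cancel' h1, hn]
    · rfl
    · rfl
  · obtain ⟨h1, h2⟩ := hcon n hn
    simp [h1, h2, Nat.mul_div_cancel' h2, Nat.add_sub_cancel' h1]

/-- The order of an aperiodic series, together with a second index of its support. -/
theorem IsAperiodic.exists_order {v : ℝ⟦X⟧} (h : IsAperiodic v) :
    ∃ p m, coeff p v ≠ 0 ∧ coeff m v ≠ 0 ∧ p < m ∧ ∀ n < p, coeff n v = 0 := by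
  classical
  have h0 : ∃ n, coeff n v ≠ 0 := by
    obtain ⟨n, hn, -⟩ := h.exists_not_dvd 0 one_lt_two
    exact ⟨n, hn⟩
  obtain ⟨m, hm, hm'⟩ : ∃ m, coeff m v ≠ 0 ∧ m ≠ Nat.find h0 := by
    obtain ⟨m, hm, hm'⟩ := h.exists_not_dvd (Nat.find h0) one_lt_two
    refine ⟨m, hm, fun he => hm' ?_⟩
    subst he; simp
  refine ⟨Nat.find h0, m, Nat.find_spec h0, hm, lt_of_le_of_ne (Nat.find_min' h0 hm) hm'.symm,
    fun n hn => ?_⟩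
  simpa using Nat.find_min h0 hn

/-! ### Mean and variance on the interval (0, R). -/

/-- The positive reals inside the disc of convergence. -/
def posDisc (v : ℝ⟦X⟧) : Set ℝ := {x | 0 < x ∧ ENNReal.ofReal x < convRadius v}

theorem isOpen_posDisc (v : ℝ⟦X⟧) : IsOpen (posDisc v) :=
  isOpen_Ioi.inter (isOpen_Iio.preimage ENNReal.continuous_ofReal)

theorem ordConnected_posDisc (v : ℝ⟦X⟧) : (posDisc v).OrdConnected :=
  ⟨fun _ hx _ hy _ hz => ⟨hx.1.trans_le hz.1, (ENNReal.ofReal_le_ofReal hz.2).trans_lt hy.2⟩⟩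

theorem ofReal_norm_lt {v : ℝ⟦X⟧} {x : ℝ} (hx : x ∈ posDisc v) :
    ENNReal.ofReal ‖x‖ < convRadius v := by
  rw [Real.norm_of_nonneg hx.1.le]; exact hx.2

theorem mem_posDisc_euler {v : ℝ⟦X⟧} {x : ℝ} (hx : x ∈ posDisc v) : x ∈ posDisc (euler v) :=
  ⟨hx.1, hx.2.trans_le (convRadius_le_euler v)⟩

theorem hasSum_evalAt {v : ℝ⟦X⟧} {x : ℝ} (hx : x ∈ posDisc v) :
    HasSum (fun n => coeff n v * x ^ n) (evalAt v x) :=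
  (summable_coeff_mul_pow (ofReal_norm_lt hx)).hasSum

theorem hasDerivAt_evalAt_real {v : ℝ⟦X⟧} {x : ℝ} (hx : x ∈ posDisc v) :
    HasDerivAt (evalAt v) (evalAt (euler v) x / x) x :=
  hasDerivAt_evalAt hx.1.ne' (ofReal_norm_lt hx)

theorem mu_eq {v : ℝ⟦X⟧} {x : ℝ} (hx : x ∈ posDisc v) :
    mu v x = evalAt (euler v) x / evalAt v x := by
  rw [mu, (hasDerivAt_evalAt_real hx).deriv, mul_div_cancel₀ _ hx.1.ne']

/-- This is the variance as second moment minus squared mean: two Euler operators insert the weight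
n². -/
theorem sigmaSq_eq {v : ℝ⟦X⟧} {x : ℝ} (hx : x ∈ posDisc v) :
    sigmaSq v x = evalAt (euler (euler v)) x / evalAt v x - mu v x ^ 2 := by
  have h1 : deriv (evalAt v) =ᶠ[𝓝 x] fun y => evalAt (euler v) y / y := by
    filter_upwards [(isOpen_posDisc v).mem_nhds hx] with y hy
    exact (hasDerivAt_evalAt_real hy).deriv
  have h2 := (hasDerivAt_evalAt_real (mem_posDisc_euler hx)).div (hasDerivAt_id x) hx.1.ne'
  have h3 : deriv (deriv (evalAt v)) x =
      (evalAt (euler (euler v)) x / x * x - evalAt (euler v) x * 1) / x ^ 2 := by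
    rw [h1.deriv_eq]; exact h2.deriv
  have hx0 := hx.1.ne'
  rw [sigmaSq, h3, mu_eq hx]
  field_simp
  ring

section Nonneg

variable {v : ℝ⟦X⟧} (hv : ∀ n, 0 ≤ coeff n v) (ha : IsAperiodic v)
include hv ha

theorem evalAt_pos {x : ℝ} (hx : x ∈ posDisc v) : 0 < evalAt v x := by
  obtain ⟨p, m, hp, -⟩ := ha.exists_order
  have h := hasSum_evalAt hx
  rw [← h.tsum_eq]
  have hx0 := hx.1
  refine h.summable.tsum_pos (fun n => mul_nonneg (hv n) (by positivity)) p ?_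
  exact mul_pos (lt_of_le_of_ne (hv p) hp.symm) (by positivity)

/-- σ² v(x) = ∑ (n - μ)² v_n x^n has nonnegative terms, and of two distinct support indices at least
one differs from μ. -/
theorem sigmaSq_pos {x : ℝ} (hx : x ∈ posDisc v) : 0 < sigmaSq v x := by
  have hpos := evalAt_pos hv ha hx
  have hx0 := hx.1
  have h0 := hasSum_evalAt hx
  have h1 := hasSum_evalAt (mem_posDisc_euler hx)
  have h2 := hasSum_evalAt (mem_posDisc_euler (mem_posDisc_euler hx))
  have hs := (h2.sub (h1.mul_left (2 * mu v x))).add (h0.mul_left (mu v x ^ 2))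
  have hE : evalAt (euler v) x = mu v x * evalAt v x := by
    rw [mu_eq hx]; field_simp
  have key : sigmaSq v x = (evalAt (euler (euler v)) x - 2 * mu v x * evalAt (euler v) x +
      mu v x ^ 2 * evalAt v x) / evalAt v x := by
    rw [sigmaSq_eq hx, hE]; field_simp; ring
  rw [key, ← hs.tsum_eq]
  refine div_pos ?_ hpos
  have hterm : ∀ n : ℕ, coeff n (euler (euler v)) * x ^ n - 2 * mu v x * (coeff n (euler v) * x ^ n)
      + mu v x ^ 2 * (coeff n v * x ^ n) = (n - mu v x) ^ 2 * (coeff n v * x ^ n) := by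
    intro n; simp only [coeff_euler]; ring
  have hnn : ∀ n : ℕ, 0 ≤ coeff n (euler (euler v)) * x ^ n -
      2 * mu v x * (coeff n (euler v) * x ^ n) + mu v x ^ 2 * (coeff n v * x ^ n) := by
    intro n; rw [hterm]
    have := hv n
    positivity
  obtain ⟨p, m, hp, hm, hpm, -⟩ := ha.exists_order
  obtain ⟨k, hk, hkm⟩ : ∃ k, coeff k v ≠ 0 ∧ (k : ℝ) - mu v x ≠ 0 := by
    by_cases h : (p : ℝ) - mu v x = 0
    · refine ⟨m, hm, fun h' => ?_⟩
      have : (p : ℝ) < m := by exact_mod_cast hpm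
      linarith
    · exact ⟨p, hp, h⟩
  refine hs.summable.tsum_pos hnn k ?_
  rw [hterm]
  have : 0 < coeff k v := lt_of_le_of_ne (hv k) hk.symm
  positivity

theorem hasDerivAt_mu {x : ℝ} (hx : x ∈ posDisc v) : HasDerivAt (mu v) (sigmaSq v x / x) x := by
  have h1 : mu v =ᶠ[𝓝 x] fun y => evalAt (euler v) y / evalAt v y := by
    filter_upwards [(isOpen_posDisc v).mem_nhds hx] with y hy
    exact mu_eq hy
  have hpos := evalAt_pos hv ha hx
  have h2 := (hasDerivAt_evalAt_real (mem_posDisc_euler hx)).div (hasDerivAt_evalAt_real hx) hpos.ne'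
  have hx0 := hx.1.ne'
  refine HasDerivAt.congr_of_eventuallyEq ?_ h1
  suffices h : sigmaSq v x / x = (evalAt (euler (euler v)) x / x * evalAt v x -
      evalAt (euler v) x * (evalAt (euler v) x / x)) / evalAt v x ^ 2 by
    rw [h]; exact h2
  rw [sigmaSq_eq hx, mu_eq hx]
  field_simp

theorem continuousOn_mu : ContinuousOn (mu v) (posDisc v) := fun _ hx =>
  (hasDerivAt_mu hv ha hx).continuousAt.continuousWithinAt

theorem continuousOn_sigmaSq : ContinuousOn (sigmaSq v) (posDisc v) := by
  have hc : ∀ w : ℝ⟦X⟧, convRadius v ≤ convRadius w → ContinuousOn (evalAt w) (posDisc v) :=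
    fun w hw x hx => (hasDerivAt_evalAt_real (v := w)
      ⟨hx.1, hx.2.trans_le hw⟩).continuousAt.continuousWithinAt
  have h2 := hc _ ((convRadius_le_euler v).trans (convRadius_le_euler _))
  exact ((h2.div (hc v le_rfl) fun x hx => (evalAt_pos hv ha hx).ne').sub
    ((continuousOn_mu hv ha).pow 2)).congr fun x hx => sigmaSq_eq hx

theorem strictMonoOn_mu : StrictMonoOn (mu v) (posDisc v) := by
  refine strictMonoOn_of_deriv_pos (ordConnected_posDisc v).convex (continuousOn_mu hv ha) ?_
  intro x hx
  have hx := interior_subset hx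
  rw [(hasDerivAt_mu hv ha hx).deriv]
  exact div_pos (sigmaSq_pos hv ha hx) hx.1

/-- The mean is squeezed between p and p + K x. In x v' - p v only exponents n > p remain, and
passing from x₀ down to x shrinks their powers by at least (x/x₀)^{p+1}, while v(x) ≥ v_p x^p; K
collects the resulting constants. -/
theorem tendsto_mu_zero (hR : 0 < convRadius v) {p : ℕ} (hp : coeff p v ≠ 0)
    (hlt : ∀ n < p, coeff n v = 0) : Tendsto (mu v) (𝓝[>] 0) (𝓝 (p : ℝ)) := by
  obtain ⟨x₀, hx₀⟩ : ∃ x, x ∈ posDisc v := exists_between_radius le_rfl (by simpa using hR)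
  have hp' : 0 < coeff p v := lt_of_le_of_ne (hv p) hp.symm
  have hx₀0 := hx₀.1
  set K := evalAt (euler v) x₀ / (x₀ ^ (p + 1) * coeff p v) with hK
  have hev : ∀ᶠ x in 𝓝[>] (0 : ℝ), x ∈ Set.Ioc 0 x₀ := Ioc_mem_nhdsGT hx₀0
  have hbd : ∀ x ∈ Set.Ioc 0 x₀, (p : ℝ) ≤ mu v x ∧ mu v x ≤ p + x * K := by
    intro x hx
    have hxD : x ∈ posDisc v := ⟨hx.1, (ENNReal.ofReal_le_ofReal hx.2).trans_lt hx₀.2⟩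
    have hx0 := hx.1
    have hpos := evalAt_pos hv ha hxD
    have h0 := hasSum_evalAt hxD
    have h1 := hasSum_evalAt (mem_posDisc_euler hxD)
    have hd := h1.sub (h0.mul_left (p : ℝ))
    have hge : coeff p v * x ^ p ≤ evalAt v x :=
      le_hasSum h0 p fun n _ => mul_nonneg (hv n) (by positivity)
    have hnn : 0 ≤ evalAt (euler v) x - p * evalAt v x := by
      refine hd.nonneg fun n => ?_
      simp only [coeff_euler]
      rcases lt_or_ge n p with h | h
      · simp [hlt n h]
      · have : (p : ℝ) ≤ n := by exact_mod_cast h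
        have h3 : 0 ≤ coeff n v * x ^ n := mul_nonneg (hv n) (by positivity)
        nlinarith
    have hle : evalAt (euler v) x - p * evalAt v x ≤
        (x / x₀) ^ (p + 1) * evalAt (euler v) x₀ := by
      refine hasSum_le (fun n => ?_) hd ((hasSum_evalAt (mem_posDisc_euler hx₀)).mul_left _)
      simp only [coeff_euler]
      have h4 : 0 ≤ (x / x₀) ^ (p + 1) * (n * coeff n v * x₀ ^ n) := by
        have := hv n
        positivity
      rcases lt_trichotomy n p with h | h | h
      · simp [hlt n h]
      · subst h
        calc _ = (0 : ℝ) := by ring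
          _ ≤ _ := h4
      · have h5 : x ^ n ≤ (x / x₀) ^ (p + 1) * x₀ ^ n := by
          have : x ^ n = (x / x₀) ^ n * x₀ ^ n := by rw [div_pow]; field_simp
          rw [this]
          refine mul_le_mul_of_nonneg_right ?_ (by positivity)
          exact pow_le_pow_of_le_one (by positivity) ((div_le_one hx₀0).2 hx.2) h
        have h6 : 0 ≤ n * coeff n v := mul_nonneg (by positivity) (hv n)
        have h7 : 0 ≤ p * (coeff n v * x ^ n) := by
          have := hv n
          positivity
        nlinarith
    rw [mu_eq hxD]
    constructor
    · rw [le_div_iff₀ hpos]; linarith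
    · have hKnn : 0 ≤ K := by
        have : 0 ≤ evalAt (euler v) x₀ := (hasSum_evalAt (mem_posDisc_euler hx₀)).nonneg fun n => by
          simp only [coeff_euler]
          have := hv n
          positivity
        positivity
      have h8 : (x / x₀) ^ (p + 1) * evalAt (euler v) x₀ = x * K * (coeff p v * x ^ p) := by
        rw [hK, div_pow, pow_succ x]; field_simp
      have h9 : x * K * (coeff p v * x ^ p) ≤ x * K * evalAt v x := by gcongr
      rw [div_le_iff₀ hpos, add_mul]
      linarith
  have hlim : Tendsto (fun x : ℝ => (p : ℝ) + x * K) (𝓝[>] 0) (𝓝 p) := by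
    have : Tendsto (fun x : ℝ => (p : ℝ) + x * K) (𝓝 0) (𝓝 (p + 0 * K)) := by
      apply Continuous.tendsto; fun_prop
    rw [zero_mul, add_zero] at this
    exact this.mono_left nhdsWithin_le_nhds
  exact tendsto_of_tendsto_of_tendsto_of_le_of_le' tendsto_const_nhds hlim
    (hev.mono fun x hx => (hbd x hx).1) (hev.mono fun x hx => (hbd x hx).2)

/-- A monotone function tends to its supremum, taken in `EReal` because it may be infinite. For
radius 0 the filter is trivial. -/
theorem tendsto_mu_toLeftOf : Tendsto (fun x => (mu v x : EReal)) (toLeftOf (convRadius v))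
    (𝓝 (⨆ x ∈ posDisc v, (mu v x : EReal))) := by
  have hev : ∀ y : ℝ, 0 ≤ y → ENNReal.ofReal y < convRadius v →
      ∀ᶠ x in toLeftOf (convRadius v), x ∈ posDisc v ∧ y < x := by
    intro y hy0 hy
    refine mem_comap.2 ⟨Set.Ioo (ENNReal.ofReal y) (convRadius v), Ioo_mem_nhdsLT hy, ?_⟩
    intro x hx
    have hyx : y < x := (ENNReal.ofReal_lt_ofReal_iff_of_nonneg hy0).1 hx.1
    exact ⟨⟨hy0.trans_lt hyx, hx.2⟩, hyx⟩
  rw [tendsto_order]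
  constructor
  · intro a hlt
    obtain ⟨x₀, hx₀, h⟩ := lt_biSup_iff.1 hlt
    filter_upwards [hev x₀ hx₀.1.le hx₀.2] with x hx
    exact h.trans (EReal.coe_lt_coe_iff.2 (strictMonoOn_mu hv ha hx₀ hx.1 hx.2))
  · intro a hlt
    by_cases hR : 0 < convRadius v
    · filter_upwards [hev 0 le_rfl (by simpa using hR)] with x hx
      exact (le_biSup (fun x => (mu v x : EReal)) hx.1).trans_lt hlt
    · have : convRadius v = 0 := by simpa using hR
      simp [toLeftOf, this]

theorem exists_saddle {A lam : ℝ}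
    (hA : Tendsto (mu v) (𝓝[>] 0) (𝓝 A)) (h1 : A < lam)
    (h2 : (lam : EReal) < ⨆ x ∈ posDisc v, (mu v x : EReal)) :
    ∃ x ∈ posDisc v, mu v x = lam := by
  obtain ⟨x₂, hx₂, h⟩ := lt_biSup_iff.1 h2
  rw [EReal.coe_lt_coe_iff] at h
  have e1 : ∀ᶠ x in 𝓝[>] (0 : ℝ), mu v x < lam := hA.eventually (gt_mem_nhds h1)
  have e2 : ∀ᶠ x in 𝓝[>] (0 : ℝ), x ∈ Set.Ioc 0 x₂ := Ioc_mem_nhdsGT hx₂.1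
  obtain ⟨x₁, hx₁, hx₁'⟩ := (e1.and e2).exists
  have hsub : Set.Icc x₁ x₂ ⊆ posDisc v := fun y hy =>
    ⟨hx₁'.1.trans_le hy.1, (ENNReal.ofReal_le_ofReal hy.2).trans_lt hx₂.2⟩
  obtain ⟨x, hx, hxe⟩ := intermediate_value_Icc hx₁'.2 ((continuousOn_mu hv ha).mono hsub)
    ⟨hx₁.le, h.le⟩
  exact ⟨x, hsub hx, hxe⟩

/-! ### Strict triangle inequality off the positive axis; vanishing below the order. -/

/-- Away from the positive axis, the modulus of an aperiodic series is strictly smaller. -/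
theorem norm_evalAt_lt {x : ℝ} (hx : x ∈ posDisc v) {ζ : ℂ} (hζ : ‖ζ‖ = 1) (hζ1 : ζ ≠ 1) :
    ‖evalAt (PowerSeries.map Complex.ofRealHom v) (x * ζ)‖ < evalAt v x := by
  have hx0 := hx.1
  have h0 := hasSum_evalAt hx
  set Z := evalAt (PowerSeries.map Complex.ofRealHom v) (x * ζ) with hZ
  have hnorm : ‖(x : ℂ) * ζ‖ = x := by simp [hζ, abs_of_pos hx0]
  have hsumZ : HasSum (fun n => ((coeff n v * x ^ n : ℝ) : ℂ) * ζ ^ n) Z := by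
    have := (summable_coeff_mul_pow (f := PowerSeries.map Complex.ofRealHom v) (z := x * ζ)
      (by rw [hnorm, convRadius_map]; exact hx.2)).hasSum
    refine (funext fun n => ?_ : (fun n => ((coeff n v * x ^ n : ℝ) : ℂ) * ζ ^ n) = _) ▸ this
    simp [mul_pow, mul_assoc]
  have hcn : ∀ n, 0 ≤ coeff n v * x ^ n := fun n => mul_nonneg (hv n) (by positivity)
  have hle : ‖Z‖ ≤ evalAt v x := hsumZ.norm_le_of_bounded h0 fun n => by
    rw [norm_mul, norm_pow, hζ, one_pow, mul_one, Complex.norm_real, Real.norm_of_nonneg (hcn n)]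
  refine lt_of_le_of_ne hle fun heq => ?_
  have hvpos := evalAt_pos hv ha hx
  have hZ0 : Z ≠ 0 := by
    rw [← norm_pos_iff, heq]; exact hvpos
  -- Assuming equality, this unit rotates Z onto the positive axis, so real parts can be compared
  -- term by term.
  set u : ℂ := starRingEnd ℂ Z / ‖Z‖ with hu
  have hun : ‖u‖ = 1 := by
    rw [hu, norm_div, RCLike.norm_conj, Complex.norm_real, norm_norm,
      div_self (norm_ne_zero_iff.2 hZ0)]
  have hZu : Z * u = ‖Z‖ := by
    have : (‖Z‖ : ℂ) ≠ 0 := by exact_mod_cast norm_ne_zero_iff.2 hZ0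
    rw [hu, ← mul_div_assoc, Complex.mul_conj, Complex.normSq_eq_norm_sq]
    push_cast
    field_simp
  have hre : HasSum (fun n => (coeff n v * x ^ n) * (ζ ^ n * u).re) (evalAt v x) := by
    have h := Complex.hasSum_re (hsumZ.mul_right u)
    rw [hZu, Complex.ofReal_re, heq] at h
    refine (funext fun n => ?_ : (fun n => (coeff n v * x ^ n) * (ζ ^ n * u).re) = _) ▸ h
    rw [mul_assoc (Complex.ofReal _), Complex.re_ofReal_mul]
  have hdiff := h0.sub hre
  rw [sub_self] at hdiff
  have hnu : ∀ n : ℕ, ‖ζ ^ n * u‖ = 1 := fun n => by rw [norm_mul, norm_pow, hζ, hun]; simp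
  have hdn : ∀ n, 0 ≤ coeff n v * x ^ n - (coeff n v * x ^ n) * (ζ ^ n * u).re := by
    intro n
    have h1 := (Complex.re_le_norm (ζ ^ n * u)).trans_eq (hnu n)
    nlinarith [hcn n]
  have hzero := (hasSum_zero_iff_of_nonneg hdn).1 hdiff
  -- The nonnegative differences sum to 0, so each vanishes; a number of modulus 1 with real part 1
  -- equals 1.
  have hone : ∀ n, coeff n v ≠ 0 → ζ ^ n * u = 1 := by
    intro n hn
    have h1 := congrFun hzero n
    simp only [Pi.zero_apply] at h1
    have h2 : coeff n v * x ^ n ≠ 0 := mul_ne_zero hn (by positivity)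
    have h3 : (ζ ^ n * u).re = 1 := by
      have : (coeff n v * x ^ n) * (1 - (ζ ^ n * u).re) = 0 := by linarith
      rcases mul_eq_zero.1 this with h | h
      · exact absurd h h2
      · linarith
    have h4 := Complex.sq_norm (ζ ^ n * u)
    rw [hnu, Complex.normSq_apply, h3] at h4
    apply Complex.ext
    · simpa using h3
    · simp only [Complex.one_im]
      nlinarith
  obtain ⟨p, m, hp, hm, hpm, hlt⟩ := ha.exists_order
  have hζ0 : ζ ≠ 0 := by rw [← norm_pos_iff, hζ]; exact one_pos
  have hpow : ∀ n, coeff n v ≠ 0 → p ≤ n ∧ ζ ^ (n - p) = 1 := by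
    intro n hn
    have hpn : p ≤ n := by
      by_contra h
      exact hn (hlt n (not_le.1 h))
    refine ⟨hpn, ?_⟩
    have h1 := (hone n hn).trans (hone p hp).symm
    have h2 := mul_right_cancel₀ (norm_pos_iff.1 (hun ▸ one_pos)) h1
    rw [← Nat.sub_add_cancel hpn, pow_add] at h2
    simpa using mul_right_cancel₀ (b := ζ ^ p) (pow_ne_zero p hζ0)
      (h2.trans (one_mul _).symm)
  -- The second support index m makes ζ a root of unity. Its order then divides n - p on the whole
  -- support, against aperiodicity unless ζ = 1.
  have hord : 0 < orderOf ζ := orderOf_pos_iff.2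
    (isOfFinOrder_iff_pow_eq_one.2 ⟨m - p, by omega, (hpow m hm).2⟩)
  have hord1 : orderOf ζ ≠ 1 := fun h => hζ1 (orderOf_eq_one_iff.1 h)
  obtain ⟨n, hn, hn'⟩ := ha.exists_not_dvd p (d := orderOf ζ) (by omega)
  exact hn' ⟨(hpow n hn).1, orderOf_dvd_of_pow_eq_one (hpow n hn).2⟩

end Nonneg

theorem coeff_mul_pow_eq_zero {v φ : ℂ⟦X⟧} {p r s : ℕ} (hlt : ∀ n < p, coeff n v = 0)
    (hr : r < p * s) : coeff r (φ * v ^ s) = 0 := by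
  have h1 : (X : ℂ⟦X⟧) ^ (p * s) ∣ φ * v ^ s := by
    rw [pow_mul]
    exact (pow_dvd_pow_of_dvd (X_pow_dvd_iff.2 hlt) s).mul_left _
  exact X_pow_dvd_iff.1 h1 r hr

/-! ### The phase near the saddle point. -/

/-- The complexification of a real power series. -/
abbrev cplx (v : ℝ⟦X⟧) : ℂ⟦X⟧ := PowerSeries.map Complex.ofRealHom v

/-- The point `x e^{iz}`. -/
def polarPt (x : ℝ) (z : ℂ) : ℂ := x * Complex.exp (Complex.I * z)

theorem polarPt_zero (x : ℝ) : polarPt x 0 = x := by simp [polarPt]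

theorem polarPt_ne_zero {x : ℝ} (hx : 0 < x) (z : ℂ) : polarPt x z ≠ 0 :=
  mul_ne_zero (by exact_mod_cast hx.ne') (Complex.exp_ne_zero _)

theorem norm_polarPt_ofReal {x : ℝ} (hx : 0 < x) (θ : ℝ) : ‖polarPt x θ‖ = x := by
  rw [polarPt, norm_mul, mul_comm Complex.I, Complex.norm_exp_ofReal_mul_I, mul_one,
    Complex.norm_real, Real.norm_of_nonneg hx.le]

theorem continuous_polarPt : Continuous fun p : ℂ × ℝ => polarPt p.2 p.1 := by
  unfold polarPt; fun_prop

theorem hasDerivAt_polarPt (x : ℝ) (z : ℂ) :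
    HasDerivAt (polarPt x) (Complex.I * polarPt x z) z := by
  have h := (((hasDerivAt_id z).const_mul Complex.I).cexp).const_mul (x : ℂ)
  have e : Complex.I * polarPt x z = x * (Complex.exp (Complex.I * id z) * (Complex.I * 1)) := by
    simp only [polarPt, id]; ring
  rw [e]; exact h

theorem hasDerivAt_evalAt_polarPt {f : ℂ⟦X⟧} {x : ℝ} (hx : 0 < x) {z : ℂ}
    (h : ENNReal.ofReal ‖polarPt x z‖ < convRadius f) :
    HasDerivAt (fun z => evalAt f (polarPt x z)) (Complex.I * evalAt (euler f) (polarPt x z)) z := by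
  have h0 := polarPt_ne_zero hx z
  have h1 := (hasDerivAt_evalAt h0 h).comp z (hasDerivAt_polarPt x z)
  have e : Complex.I * evalAt (euler f) (polarPt x z) =
      evalAt (euler f) (polarPt x z) / polarPt x z * (Complex.I * polarPt x z) := by
    field_simp
  rw [e]; exact h1

theorem continuousAt_evalAt_polarPt {f : ℂ⟦X⟧} {x : ℝ} (hx : 0 < x) {z : ℂ}
    (h : ENNReal.ofReal ‖polarPt x z‖ < convRadius f) :
    ContinuousAt (fun p : ℂ × ℝ => evalAt f (polarPt p.2 p.1)) (z, x) :=
  ContinuousAt.comp (f := fun p : ℂ × ℝ => polarPt p.2 p.1) (g := evalAt f) (x := (z, x))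
    (hasDerivAt_evalAt (polarPt_ne_zero hx z) h).continuousAt continuous_polarPt.continuousAt

/-- The phase `-(log (v(x e^{iz}) / v(x)) - i μ(v; x) z)`. -/
def phase (v : ℝ⟦X⟧) (x : ℝ) (z : ℂ) : ℂ :=
  -(Complex.log (evalAt (cplx v) (polarPt x z) / ((evalAt v x : ℝ) : ℂ)) - Complex.I * mu v x * z)

/-- The phase divided by `z ^ 2`. -/
def reducedPhase (v : ℝ⟦X⟧) (x : ℝ) : ℂ → ℂ := dslope (dslope (phase v x) 0) 0

/-- On the disc of radius `ρ` the quotient `v(x e^{iz}) / v(x)` is close to `1`. -/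
def GoodRadius (v : ℝ⟦X⟧) (x ρ : ℝ) : Prop :=
  ∀ z : ℂ, ‖z‖ ≤ ρ → ENNReal.ofReal ‖polarPt x z‖ < convRadius v ∧
    ‖evalAt (cplx v) (polarPt x z) / ((evalAt v x : ℝ) : ℂ) - 1‖ ≤ 1 / 2

section Local

variable {v : ℝ⟦X⟧} (hv : ∀ n, 0 ≤ coeff n v) (ha : IsAperiodic v)
  {x ρ : ℝ} (hx : x ∈ posDisc v) (hρ : 0 < ρ) (hg : GoodRadius v x ρ)

theorem mem_slitPlane_of_norm_sub_one_le {w : ℂ} (h : ‖w - 1‖ ≤ 1 / 2) : w ∈ Complex.slitPlane := by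
  refine Or.inl ?_
  have h1 := (abs_le.1 ((Complex.abs_re_le_norm (w - 1)).trans h)).1
  simp only [Complex.sub_re, Complex.one_re] at h1
  linarith

include hv ha hx in
theorem phase_zero : phase v x 0 = 0 := by
  have h : ((evalAt v x : ℝ) : ℂ) ≠ 0 := by exact_mod_cast (evalAt_pos hv ha hx).ne'
  simp [phase, polarPt_zero, evalAt_map_ofReal, h]

include hv ha hx in
theorem hasDerivAt_phase (hg : GoodRadius v x ρ) {z : ℂ} (hz : ‖z‖ ≤ ρ) :
    HasDerivAt (phase v x) (-(Complex.I * evalAt (euler (cplx v)) (polarPt x z) /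
      evalAt (cplx v) (polarPt x z) - Complex.I * mu v x)) z := by
  obtain ⟨h1, h2⟩ := hg z hz
  have h : ((evalAt v x : ℝ) : ℂ) ≠ 0 := by exact_mod_cast (evalAt_pos hv ha hx).ne'
  have hs := mem_slitPlane_of_norm_sub_one_le h2
  have hne : evalAt (cplx v) (polarPt x z) ≠ 0 := by
    intro h0
    rw [h0, zero_div] at hs
    simp at hs
  have hd := ((hasDerivAt_evalAt_polarPt hx.1 (f := cplx v)
    (by rwa [convRadius_map])).div_const ((evalAt v x : ℝ) : ℂ)).clog hs
  have hd2 := (hd.sub ((hasDerivAt_id z).const_mul (Complex.I * mu v x))).neg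
  have e : -(Complex.I * evalAt (euler (cplx v)) (polarPt x z) /
      evalAt (cplx v) (polarPt x z) - Complex.I * mu v x) =
    -(Complex.I * evalAt (euler (cplx v)) (polarPt x z) / ((evalAt v x : ℝ) : ℂ) /
      (evalAt (cplx v) (polarPt x z) / ((evalAt v x : ℝ) : ℂ)) - Complex.I * mu v x * 1) := by
    field_simp
  rw [e]; exact hd2

include hv ha hx in
theorem differentiableOn_phase (hg : GoodRadius v x ρ) :
    DifferentiableOn ℂ (phase v x) (Metric.closedBall 0 ρ) := fun z hz =>
  (hasDerivAt_phase hv ha hx hg (by simpa using hz)).differentiableAt.differentiableWithinAt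

include hv ha hx hρ hg in
theorem deriv_phase_zero : deriv (phase v x) 0 = 0 := by
  rw [(hasDerivAt_phase hv ha hx hg (z := 0) (by simpa using hρ.le)).deriv, polarPt_zero,
    euler_map, evalAt_map_ofReal, evalAt_map_ofReal, mu_eq hx]
  push_cast; ring

include hv ha hx hρ hg in
theorem deriv_deriv_phase_zero : deriv (deriv (phase v x)) 0 = sigmaSq v x := by
  have hpos : ((evalAt v x : ℝ) : ℂ) ≠ 0 := by exact_mod_cast (evalAt_pos hv ha hx).ne'
  have h1 : deriv (phase v x) =ᶠ[𝓝 0] fun z => -(Complex.I * evalAt (euler (cplx v)) (polarPt x z) /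
      evalAt (cplx v) (polarPt x z) - Complex.I * mu v x) := by
    filter_upwards [Metric.closedBall_mem_nhds (0 : ℂ) hρ] with z hz
    exact (hasDerivAt_phase hv ha hx hg (by simpa using hz)).deriv
  have hr : ENNReal.ofReal ‖polarPt x 0‖ < convRadius (cplx v) := by
    rw [convRadius_map]; exact (hg 0 (by simpa using hρ.le)).1
  have hd1 := (hasDerivAt_evalAt_polarPt hx.1
    (hr.trans_le (convRadius_le_euler _))).const_mul Complex.I
  have hd0 := hasDerivAt_evalAt_polarPt hx.1 hr
  have hd := ((hd1.div hd0 (by rwa [polarPt_zero, evalAt_map_ofReal])).sub_const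
    (Complex.I * mu v x)).neg
  rw [h1.deriv_eq]
  refine hd.deriv.trans ?_
  rw [polarPt_zero, euler_map, euler_map, evalAt_map_ofReal, evalAt_map_ofReal, evalAt_map_ofReal,
    sigmaSq_eq hx, mu_eq hx]
  push_cast
  field_simp
  ring_nf
  rw [Complex.I_sq]; ring

include hv ha hx hρ hg in
-- Third-order Taylor remainder: |log(1 + w)| ≤ (3/2)|w| ≤ 3/4 bounds the phase by 1 + |μ|ρ on the
-- disc. The constant involves x only through μ, so it is uniform on compact sets.
theorem norm_phase_sub_le {z : ℂ} (hz : ‖z‖ ≤ ρ / 2) :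
    ‖phase v x z - (sigmaSq v x / 2 : ℝ) * z ^ 2‖ ≤
      2 * (1 + |mu v x| * ρ) * (‖z‖ / ρ) ^ 3 := by
  have hb : ∀ z : ℂ, ‖z‖ ≤ ρ → ‖phase v x z‖ ≤ 1 + |mu v x| * ρ := by
    intro z hz
    obtain ⟨-, h2⟩ := hg z hz
    have h3 := Complex.norm_log_one_add_half_le_self h2
    rw [add_sub_cancel] at h3
    rw [phase, norm_neg]
    refine (norm_sub_le _ _).trans (add_le_add (by linarith) ?_)
    rw [norm_mul, norm_mul, Complex.norm_I, one_mul, Complex.norm_real, Real.norm_eq_abs]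
    gcongr
  have h := norm_sub_taylor_le hρ (differentiableOn_phase hv ha hx hg) hb 3 hz
  have e : ∑ k ∈ Finset.range 3, taylorCoeff (phase v x) k * z ^ k =
      (sigmaSq v x / 2 : ℝ) * z ^ 2 := by
    have e2 : iteratedDeriv 2 (phase v x) 0 = sigmaSq v x := by
      rw [iteratedDeriv_succ, iteratedDeriv_one]
      exact deriv_deriv_phase_zero hv ha hx hρ hg
    simp [Finset.sum_range_succ, taylorCoeff, phase_zero hv ha hx,
      deriv_phase_zero hv ha hx hρ hg, e2]
    left; ring
  rwa [e] at h

include hv ha hx hρ hg in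
theorem differentiableOn_reducedPhase :
    DifferentiableOn ℂ (reducedPhase v x) (Metric.closedBall 0 ρ) := by
  have hn := Metric.closedBall_mem_nhds (0 : ℂ) hρ
  exact (Complex.differentiableOn_dslope hn).2 ((Complex.differentiableOn_dslope hn).2
    (differentiableOn_phase hv ha hx hg))

include hv ha hx hρ hg in
theorem sq_mul_reducedPhase (z : ℂ) : z ^ 2 * reducedPhase v x z = phase v x z := by
  have h1 := sub_smul_dslope (dslope (phase v x) 0) 0 z
  have h2 := sub_smul_dslope (phase v x) 0 z
  rw [dslope_same, deriv_phase_zero hv ha hx hρ hg] at h1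
  rw [phase_zero hv ha hx] at h2
  simp only [sub_zero, smul_eq_mul] at h1 h2
  rw [pow_two, mul_assoc, reducedPhase, h1, h2]

include hv ha hx hρ hg in
-- Divide the previous estimate by z² and pass to z = 0 by continuity.
theorem norm_reducedPhase_sub_le {z : ℂ} (hz : ‖z‖ < ρ / 2) :
    ‖reducedPhase v x z - (sigmaSq v x / 2 : ℝ)‖ ≤ 2 * (1 + |mu v x| * ρ) / ρ ^ 3 * ‖z‖ := by
  have hne : ∀ z : ℂ, ‖z‖ ≤ ρ / 2 → z ≠ 0 →
      ‖reducedPhase v x z - (sigmaSq v x / 2 : ℝ)‖ ≤ 2 * (1 + |mu v x| * ρ) / ρ ^ 3 * ‖z‖ := by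
    intro z hz h0
    have h := norm_phase_sub_le hv ha hx hρ hg hz
    rw [← sq_mul_reducedPhase hv ha hx hρ hg, mul_comm (Complex.ofReal _), ← mul_sub, norm_mul,
      norm_pow] at h
    have hz0 : 0 < ‖z‖ ^ 2 := by positivity
    refine le_of_mul_le_mul_left (h.trans_eq ?_) hz0
    rw [div_pow]; field_simp
  by_cases h0 : z = 0
  · subst h0
    have hc : ContinuousAt (reducedPhase v x) 0 :=
      (differentiableOn_reducedPhase hv ha hx hρ hg).continuousOn.continuousAt
        (Metric.closedBall_mem_nhds _ hρ)
    have h1 : Tendsto (fun z => ‖reducedPhase v x z - (sigmaSq v x / 2 : ℝ)‖) (𝓝[≠] 0)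
        (𝓝 ‖reducedPhase v x 0 - (sigmaSq v x / 2 : ℝ)‖) :=
      ((hc.sub continuousAt_const).norm).tendsto.mono_left nhdsWithin_le_nhds
    have h2 : Tendsto (fun z : ℂ => 2 * (1 + |mu v x| * ρ) / ρ ^ 3 * ‖z‖) (𝓝[≠] 0)
        (𝓝 (2 * (1 + |mu v x| * ρ) / ρ ^ 3 * ‖(0 : ℂ)‖)) :=
      (by fun_prop : Continuous fun z : ℂ =>
        2 * (1 + |mu v x| * ρ) / ρ ^ 3 * ‖z‖).continuousAt.tendsto.mono_left nhdsWithin_le_nhds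
    refine le_of_tendsto_of_tendsto h1 h2 ?_
    filter_upwards [self_mem_nhdsWithin,
      mem_nhdsWithin_of_mem_nhds (Metric.closedBall_mem_nhds (0 : ℂ) (half_pos hρ))] with z h3 h4
    exact hne z (by simpa using h4) h3
  · exact hne z hz.le h0

include hv ha hx hρ hg in
theorem reducedPhase_zero : reducedPhase v x 0 = (sigmaSq v x / 2 : ℝ) := by
  have h := norm_reducedPhase_sub_le hv ha hx hρ hg (z := 0) (by simpa using hρ)
  rw [norm_zero, mul_zero] at h
  exact sub_eq_zero.1 (norm_le_zero_iff.1 h)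

include hv ha hx hρ hg in
theorem evalAt_polarPt_eq_exp {z : ℂ} (hz : ‖z‖ ≤ ρ) :
    evalAt (cplx v) (polarPt x z) = evalAt v x *
      Complex.exp (Complex.I * mu v x * z - z ^ 2 * reducedPhase v x z) := by
  have hpos : ((evalAt v x : ℝ) : ℂ) ≠ 0 := by exact_mod_cast (evalAt_pos hv ha hx).ne'
  obtain ⟨h1, h2⟩ := hg z hz
  rw [sq_mul_reducedPhase hv ha hx hρ hg, phase]
  have hs := mem_slitPlane_of_norm_sub_one_le h2
  rw [show ∀ a b : ℂ, a - -(b - a) = b by intro a b; ring,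
    Complex.exp_log (Complex.slitPlane_ne_zero hs)]
  field_simp

end Local

/-! ### Uniformity over a compact set of saddle points. -/

section Uniform

variable {v : ℝ⟦X⟧} (hv : ∀ n, 0 ≤ coeff n v) (ha : IsAperiodic v)
  {J : Set ℝ} (hJ : IsCompact J) (hJv : J ⊆ posDisc v)

include hv ha hJ hJv

theorem exists_goodRadius : ∃ ρ : ℝ, 0 < ρ ∧ ∀ x ∈ J, GoodRadius v x ρ := by
  have hev : ∀ᶠ z : ℂ in 𝓝 0, ∀ x ∈ J, ENNReal.ofReal ‖polarPt x z‖ < convRadius v ∧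
      ‖evalAt (cplx v) (polarPt x z) / ((evalAt v x : ℝ) : ℂ) - 1‖ ≤ 1 / 2 := by
    refine hJ.eventually_forall_of_forall_eventually fun x hx => ?_
    have hxv := hJv hx
    have hpos : ((evalAt v x : ℝ) : ℂ) ≠ 0 := by exact_mod_cast (evalAt_pos hv ha hxv).ne'
    have hr : ENNReal.ofReal ‖polarPt x 0‖ < convRadius v := by
      rw [polarPt_zero, Complex.norm_real]; exact ofReal_norm_lt hxv
    have c1 : Continuous fun p : ℂ × ℝ => ENNReal.ofReal ‖polarPt p.2 p.1‖ :=
      ENNReal.continuous_ofReal.comp continuous_polarPt.norm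
    have c2 : ContinuousAt (fun p : ℂ × ℝ => evalAt (cplx v) (polarPt p.2 p.1)) (0, x) :=
      continuousAt_evalAt_polarPt hxv.1 (by rwa [convRadius_map])
    have c3 : ContinuousAt (fun p : ℂ × ℝ => ((evalAt v p.2 : ℝ) : ℂ)) (0, x) :=
      Complex.continuous_ofReal.continuousAt.comp
        (ContinuousAt.comp (f := fun p : ℂ × ℝ => p.2) (g := evalAt v) (x := ((0 : ℂ), x))
          (hasDerivAt_evalAt_real hxv).continuousAt continuousAt_snd)
    have c4 := ((c2.div c3 hpos).sub_const 1).norm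
    have e : ‖evalAt (cplx v) (polarPt x 0) / ((evalAt v x : ℝ) : ℂ) - 1‖ < 1 / 2 := by
      rw [polarPt_zero, evalAt_map_ofReal, div_self hpos]; norm_num
    filter_upwards [c1.continuousAt.eventually (gt_mem_nhds hr),
      c4.eventually (gt_mem_nhds e)] with p h1 h2
    exact ⟨h1, h2.le⟩
  obtain ⟨ε, hε, h⟩ := Metric.eventually_nhds_iff.1 hev
  refine ⟨ε / 2, by positivity, fun x hx z hz => h ?_ x hx⟩
  rw [dist_zero_right]; linarith

/-- By compactness σ² has a positive minimum c on J, so the reduced phase is at least c/2 at the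
origin; on a small common disc it moves by at most c/4. -/
theorem exists_uniform_saddle_data (φ : ℂ⟦X⟧) (hφ : convRadius v ≤ convRadius φ) :
    ∃ ρ C c : ℝ, 0 < ρ ∧ ρ ≤ 1 ∧ 0 < c ∧ ∀ x ∈ J, GoodRadius v x ρ ∧
      DifferentiableOn ℂ (fun z => evalAt φ (polarPt x z)) (Metric.closedBall 0 ρ) ∧
      (∀ z : ℂ, ‖z‖ ≤ ρ → ‖evalAt φ (polarPt x z)‖ ≤ C) ∧
      (∀ z : ℂ, ‖z‖ ≤ ρ → c ≤ (reducedPhase v x z).re) := by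
  obtain ⟨ρ₀, hρ₀, hg⟩ := exists_goodRadius hv ha hJ hJv
  obtain ⟨c, hc, hcJ⟩ : ∃ c, 0 < c ∧ ∀ x ∈ J, c ≤ sigmaSq v x := by
    rcases J.eq_empty_or_nonempty with h | h
    · exact ⟨1, one_pos, by simp [h]⟩
    · obtain ⟨x₀, hx₀, hmin⟩ := hJ.exists_isMinOn h ((continuousOn_sigmaSq hv ha).mono hJv)
      exact ⟨_, sigmaSq_pos hv ha (hJv hx₀), hmin⟩
  obtain ⟨m, hm⟩ := hJ.exists_bound_of_continuousOn ((continuousOn_mu hv ha).mono hJv)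
  set m' := max m 0
  set L := 2 * (1 + m' * ρ₀) / ρ₀ ^ 3 with hL
  have hm'0 : 0 ≤ m' := le_max_right _ _
  have hLpos : 0 < L := by positivity
  -- The bound 1 keeps the central arc inside [-π, π], ρ₀/4 keeps z strictly inside the half disc,
  -- and c/4/L limits the variation of the reduced phase to c/4.
  set ρ := min 1 (min (ρ₀ / 4) (c / 4 / L)) with hρdef
  have hρ : 0 < ρ := by positivity
  have hρ1 : ρ ≤ ρ₀ / 4 := (min_le_right _ _).trans (min_le_left _ _)
  have hρ2 : ρ ≤ c / 4 / L := (min_le_right _ _).trans (min_le_right _ _)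
  have hg' : ∀ x ∈ J, GoodRadius v x ρ := fun x hx z hz => hg x hx z (by linarith)
  obtain ⟨C, hC⟩ := ((isCompact_closedBall (0 : ℂ) ρ).prod hJ).exists_bound_of_continuousOn
    (f := fun p : ℂ × ℝ => evalAt φ (polarPt p.2 p.1)) fun p hp =>
      (continuousAt_evalAt_polarPt (hJv hp.2).1
        (((hg' p.2 hp.2 p.1 (by simpa using hp.1)).1).trans_le hφ)).continuousWithinAt
  refine ⟨ρ, C, c / 4, hρ, min_le_left _ _, by positivity, fun x hx => ⟨hg' x hx, ?_, ?_, ?_⟩⟩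
  · intro z hz
    exact (hasDerivAt_evalAt_polarPt (hJv hx).1 (((hg' x hx z
      (by simpa using hz)).1).trans_le hφ)).differentiableAt.differentiableWithinAt
  · intro z hz
    exact hC (z, x) ⟨by simpa using hz, hx⟩
  · intro z hz
    have h1 := norm_reducedPhase_sub_le hv ha (hJv hx) hρ₀ (hg x hx) (z := z) (by linarith)
    have h2 : 2 * (1 + |mu v x| * ρ₀) / ρ₀ ^ 3 * ‖z‖ ≤ L * ρ := by
      rw [hL]
      have : |mu v x| ≤ m' := (hm x hx).trans (le_max_left _ _)
      gcongr
    have h3 : L * ρ ≤ c / 4 := by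
      rw [le_div_iff₀ hLpos] at hρ2; linarith
    have h4 := (abs_le.1 ((Complex.abs_re_le_norm _).trans (h1.trans (h2.trans h3)))).1
    rw [Complex.sub_re, Complex.ofReal_re] at h4
    have := hcJ x hx
    linarith

/-- The continuous ratio |v(xe^{iθ})| / v(x) attains its maximum over a compact set of pairs (θ, x)
avoiding θ = 0, and the maximum is below 1 by `norm_evalAt_lt`. -/
theorem exists_minor_arc_bound {δ : ℝ} (hδ : 0 < δ) :
    ∃ κ : ℝ, 0 ≤ κ ∧ κ < 1 ∧ ∀ x ∈ J, ∀ θ : ℝ, δ ≤ |θ| → |θ| ≤ Real.pi →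
      ‖evalAt (cplx v) (polarPt x θ)‖ ≤ κ * evalAt v x := by
  set S : Set ℝ := {θ | δ ≤ |θ| ∧ |θ| ≤ Real.pi} with hS
  have hScl : IsClosed S := (isClosed_le continuous_const continuous_abs).inter
    (isClosed_le continuous_abs continuous_const)
  have hScomp : IsCompact S := (isCompact_Icc (a := -Real.pi) (b := Real.pi)).of_isClosed_subset hScl
    fun θ hθ => abs_le.1 hθ.2
  have hlt : ∀ x ∈ J, ∀ θ ∈ S, ‖evalAt (cplx v) (polarPt x θ)‖ < evalAt v x := by
    intro x hx θ hθ
    refine norm_evalAt_lt hv ha (hJv hx) (ζ := Complex.exp (Complex.I * θ)) ?_ ?_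
    · rw [mul_comm]; exact Complex.norm_exp_ofReal_mul_I θ
    · intro h
      obtain ⟨n, hn⟩ := Complex.exp_eq_one_iff.1 h
      have h1 : (θ : ℂ) = ((n * (2 * Real.pi) : ℝ) : ℂ) := by
        have := mul_left_cancel₀ Complex.I_ne_zero
          (hn.trans (by ring : _ = Complex.I * (n * (2 * Real.pi))))
        rw [this]; push_cast; ring
      have h2 : θ = n * (2 * Real.pi) := by exact_mod_cast h1
      have hpi := Real.pi_pos
      rcases eq_or_ne n 0 with h0 | h0
      · have : |θ| = 0 := by rw [h2, h0]; simp
        linarith [hθ.1]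
      · have h3 : (1 : ℝ) ≤ |(n : ℝ)| := by exact_mod_cast Int.one_le_abs h0
        have h4 : |θ| = |(n : ℝ)| * (2 * Real.pi) := by
          rw [h2, abs_mul, abs_of_pos (by positivity : 0 < 2 * Real.pi)]
        nlinarith [hθ.2]
  rcases (S ×ˢ J).eq_empty_or_nonempty with hempty | hne
  · refine ⟨0, le_rfl, one_pos, fun x hx θ h1 h2 => ?_⟩
    have : (θ, x) ∈ S ×ˢ J := ⟨⟨h1, h2⟩, hx⟩
    rw [hempty] at this
    exact this.elim
  · have hcont : ContinuousOn
        (fun p : ℝ × ℝ => ‖evalAt (cplx v) (polarPt p.2 p.1)‖ / evalAt v p.2) (S ×ˢ J) := by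
      intro p hp
      have hxv := hJv hp.2
      have c2 : ContinuousAt (fun p : ℝ × ℝ => evalAt (cplx v) (polarPt p.2 p.1)) p :=
        ContinuousAt.comp (f := fun p : ℝ × ℝ => ((p.1 : ℂ), p.2))
          (g := fun p : ℂ × ℝ => evalAt (cplx v) (polarPt p.2 p.1)) (x := p)
          (continuousAt_evalAt_polarPt hxv.1 (by
            rw [norm_polarPt_ofReal hxv.1, convRadius_map]; exact hxv.2))
          (by fun_prop)
      have c3 : ContinuousAt (fun p : ℝ × ℝ => evalAt v p.2) p :=
        ContinuousAt.comp (f := fun p : ℝ × ℝ => p.2) (g := evalAt v) (x := p)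
          (hasDerivAt_evalAt_real hxv).continuousAt continuousAt_snd
      exact (c2.norm.div c3 (evalAt_pos hv ha hxv).ne').continuousWithinAt
    obtain ⟨p, hp, hmax⟩ := (hScomp.prod hJ).exists_isMaxOn hne hcont
    have hpos := evalAt_pos hv ha (hJv hp.2)
    refine ⟨_, div_nonneg (norm_nonneg _) hpos.le, (div_lt_one hpos).2 (hlt p.2 hp.2 p.1 hp.1),
      fun x hx θ h1 h2 => ?_⟩
    have h3 := isMaxOn_iff.1 hmax (θ, x) ⟨⟨h1, h2⟩, hx⟩
    exact (div_le_iff₀ (evalAt_pos hv ha (hJv hx))).1 h3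

end Uniform

/-! ### Coefficients at the saddle point and the uniform expansion. -/

/-- The `k`-th coefficient of the asymptotic expansion, as a function of the saddle point `x`. -/
def saddleCoeff (v : ℝ⟦X⟧) (φ : ℂ⟦X⟧) (k : ℕ) (x : ℝ) : ℂ :=
  (1 / (2 * Real.pi) : ℝ) *
    laplaceCoeff (fun z => evalAt φ (polarPt x z)) (reducedPhase v x) k

theorem saddleCoeff_zero {v : ℝ⟦X⟧} (hv : ∀ n, 0 ≤ coeff n v) (ha : IsAperiodic v) (φ : ℂ⟦X⟧)
    {x : ℝ} (hx : x ∈ posDisc v) :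
    saddleCoeff v φ 0 x = evalAt φ (x : ℂ) / (√(2 * Real.pi * sigmaSq v x) : ℝ) := by
  obtain ⟨ρ, hρ, hg⟩ := exists_goodRadius hv ha (isCompact_singleton (x := x))
    (Set.singleton_subset_iff.2 hx)
  have hσ := sigmaSq_pos hv ha hx
  have hpi := Real.pi_pos
  rw [saddleCoeff, laplaceCoeff_zero _ _ (reducedPhase_zero hv ha hx hρ (hg x rfl)), polarPt_zero]
  have h2 : 1 / (2 * Real.pi) * √(Real.pi / (sigmaSq v x / 2)) =
      (√(2 * Real.pi * sigmaSq v x))⁻¹ := by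
    have h3 : √(Real.pi / (sigmaSq v x / 2)) * √(2 * Real.pi * sigmaSq v x) = 2 * Real.pi := by
      rw [← Real.sqrt_mul (by positivity),
        show Real.pi / (sigmaSq v x / 2) * (2 * Real.pi * sigmaSq v x) = (2 * Real.pi) ^ 2 by
          field_simp]
      exact Real.sqrt_sq (by positivity)
    refine eq_inv_of_mul_eq_one_left ?_
    rw [mul_assoc, h3]
    field_simp
  rw [div_eq_mul_inv (evalAt φ _), ← Complex.ofReal_inv, ← h2]
  push_cast; ring

theorem scale_eq (v : ℝ⟦X⟧) (x : ℝ) (r s : ℕ) :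
    scale v x r s = evalAt v x ^ s * x ^ (-(r : ℤ)) * (√s)⁻¹ := by
  rw [scale, Real.rpow_neg (by positivity), Real.sqrt_eq_rpow]

/-- Absorbs the exponentially small outer arcs into the error term of any order N. -/
theorem exists_pow_le_inv {κ : ℝ} (h0 : 0 ≤ κ) (h1 : κ < 1) (N : ℕ) :
    ∃ D : ℝ, 0 ≤ D ∧ ∀ s : ℕ, 0 < s → κ ^ s ≤ D * ((√s)⁻¹ * ((s : ℝ) ^ N)⁻¹) := by
  obtain ⟨D, hD⟩ := (tendsto_pow_const_mul_const_pow_of_lt_one (N + 1) h0 h1).bddAbove_range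
  have hD' : ∀ s : ℕ, (s : ℝ) ^ (N + 1) * κ ^ s ≤ D := fun s => hD ⟨s, rfl⟩
  have hD0 : 0 ≤ D := by simpa using hD' 0
  refine ⟨D, hD0, fun s hs => ?_⟩
  have hs1 : (1 : ℝ) ≤ s := by exact_mod_cast hs
  have hs0 : (0 : ℝ) < s := by linarith
  have hsq : √(s : ℝ) ≤ s := by
    rw [Real.sqrt_le_left hs0.le]; nlinarith
  have hsq0 : 0 < √(s : ℝ) := Real.sqrt_pos.2 hs0
  calc κ ^ s ≤ D * ((s : ℝ)⁻¹ * ((s : ℝ) ^ N)⁻¹) := by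
        rw [← mul_inv, ← pow_succ', ← div_eq_mul_inv, le_div_iff₀ (by positivity), mul_comm]
        exact hD' s
    _ ≤ _ := by gcongr

theorem integral_symm_split {f : ℝ → ℂ} (hf : Continuous f) (δ b : ℝ) :
    ∫ θ in (-b)..b, f θ = (∫ θ in (-δ)..δ, f θ) +
      ((∫ θ in (-b)..(-δ), f θ) + ∫ θ in δ..b, f θ) := by
  have hi : ∀ a b : ℝ, IntervalIntegrable f MeasureTheory.volume a b := fun a b =>
    hf.intervalIntegrable a b
  rw [← intervalIntegral.integral_add_adjacent_intervals (hi (-b) (-δ)) (hi (-δ) b),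
    ← intervalIntegral.integral_add_adjacent_intervals (hi (-δ) δ) (hi δ b)]
  ring

section Main

variable {v : ℝ⟦X⟧} (hv : ∀ n, 0 ≤ coeff n v) (ha : IsAperiodic v)

theorem coeff_mul_pow_eq_integral {φ : ℂ⟦X⟧} (hφ : convRadius v ≤ convRadius φ) {x : ℝ}
    (hx : x ∈ posDisc v) (r s : ℕ) :
    coeff r (φ * cplx v ^ s) = (1 / (2 * Real.pi) : ℝ) * (x : ℂ) ^ (-(r : ℤ)) *
      ∫ θ in (-Real.pi)..Real.pi, evalAt φ (polarPt x θ) * evalAt (cplx v) (polarPt x θ) ^ s *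
        Complex.exp (-(Complex.I * r * θ)) := by
  have h1 : AbsConvAt φ x := summable_norm_coeff_mul_pow hx.1.le (hx.2.trans_le hφ)
  have h2 : AbsConvAt (cplx v) x :=
    summable_norm_coeff_mul_pow hx.1.le (by rw [convRadius_map]; exact hx.2)
  obtain ⟨h3, h4⟩ := h2.pow_and_eval hx.1.le s
  obtain ⟨h5, h6⟩ := h1.mul_and_eval hx.1.le h3
  rw [coeff_eq_integral hx.1 h5 r]
  congr 1
  refine intervalIntegral.integral_congr fun θ _ => ?_
  have hn := norm_polarPt_ofReal hx.1 θ
  have e : (x : ℂ) * Complex.exp (Complex.I * θ) = polarPt x θ := rfl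
  simp only [e]
  rw [h6 _ hn, h4 _ hn]

theorem continuous_evalAt_polarPt {f : ℂ⟦X⟧} {x : ℝ} (hx : 0 < x)
    (hf : ENNReal.ofReal x < convRadius f) :
    Continuous fun θ : ℝ => evalAt f (polarPt x θ) := by
  refine continuous_iff_continuousAt.2 fun θ => ?_
  exact ContinuousAt.comp (f := fun θ : ℝ => (θ : ℂ)) (g := fun z => evalAt f (polarPt x z))
    (hasDerivAt_evalAt_polarPt hx (by rwa [norm_polarPt_ofReal hx])).continuousAt
    Complex.continuous_ofReal.continuousAt

include hv ha in
-- The saddle point method itself: Laplace's method on |θ| ≤ ρ/2 and the factor κ^s on the rest of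
-- the circle, with every constant fixed before x, r, s.
theorem exists_uniform_expansion_bound {φ : ℂ⟦X⟧} (hφ : convRadius v ≤ convRadius φ)
    {J : Set ℝ} (hJ : IsCompact J) (hJv : J ⊆ posDisc v) (N : ℕ) :
    ∃ M : ℝ, ∀ x ∈ J, ∀ r s : ℕ, 0 < s → mu v x = (r : ℝ) / (s : ℝ) →
      ‖coeff r (φ * cplx v ^ s) - (scale v x r s : ℂ) *
          ∑ k ∈ Finset.range N, saddleCoeff v φ k x * ((s : ℂ) ^ k)⁻¹‖ ≤
        M * scale v x r s * ((s : ℝ) ^ N)⁻¹ := by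
  obtain ⟨ρ, C, c, hρ, hρ1, hc, hdata⟩ := exists_uniform_saddle_data hv ha hJ hJv φ hφ
  obtain ⟨κ, hκ0, hκ1, hκ⟩ := exists_minor_arc_bound hv ha hJ hJv (half_pos hρ)
  obtain ⟨D, hD0, hD⟩ := exists_pow_le_inv hκ0 hκ1 N
  obtain ⟨P, hP⟩ : ∃ P, ∀ x ∈ J, ∀ θ ∈ Set.Icc (-Real.pi) Real.pi, ‖evalAt φ (polarPt x θ)‖ ≤ P := by
    obtain ⟨P, hP⟩ := ((isCompact_Icc (a := -Real.pi) (b := Real.pi)).prod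
      hJ).exists_bound_of_continuousOn
      (f := fun p : ℝ × ℝ => evalAt φ (polarPt p.2 p.1)) fun p hp =>
        (ContinuousAt.comp (f := fun p : ℝ × ℝ => ((p.1 : ℂ), p.2))
          (g := fun p : ℂ × ℝ => evalAt φ (polarPt p.2 p.1)) (x := p)
          (continuousAt_evalAt_polarPt (hJv hp.2).1 (by
            rw [norm_polarPt_ofReal (hJv hp.2).1]; exact (hJv hp.2).2.trans_le hφ))
          (by fun_prop)).continuousWithinAt
    exact ⟨P, fun x hx θ hθ => hP (θ, x) ⟨hθ, hx⟩⟩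
  set D₁ := ((2 * N : ℕ) + 2) * C * (2 / ρ) ^ (2 * N) *
        (∫ w : ℝ, |w| ^ (2 * N) * Real.exp (-c * w ^ 2)) with hD₁
  refine ⟨1 / (2 * Real.pi) * (D₁ + 2 * Real.pi * P * D), fun x hx r s hs hmu => ?_⟩
  obtain ⟨hg, hG, hGC, hqc⟩ := hdata x hx
  have hxv := hJv hx
  have hx0 := hxv.1
  have hvpos := evalAt_pos hv ha hxv
  have hpi := Real.pi_pos
  have hpi3 := Real.pi_gt_three
  have hs0 : (0 : ℝ) < s := by exact_mod_cast hs
  have hP0 : 0 ≤ P := (norm_nonneg _).trans (hP x hx 0 ⟨by linarith, hpi.le⟩)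
  set G : ℂ → ℂ := fun z => evalAt φ (polarPt x z) with hGdef
  set f : ℝ → ℂ := fun θ => evalAt φ (polarPt x θ) * evalAt (cplx v) (polarPt x θ) ^ s *
        Complex.exp (-(Complex.I * r * θ)) with hf
  have hfc : Continuous f := by
    have c1 := continuous_evalAt_polarPt hx0 (hxv.2.trans_le hφ)
    have c2 := continuous_evalAt_polarPt (f := cplx v) hx0 (by rw [convRadius_map]; exact hxv.2)
    exact (c1.mul (c2.pow s)).mul (by fun_prop)
  have hmid : ∫ θ in (-(ρ / 2))..(ρ / 2), f θ = (evalAt v x : ℝ) ^ s *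
      ∫ u in (-(ρ / 2))..(ρ / 2), G u *
        Complex.exp (-((s : ℝ) * (u : ℂ) ^ 2 * reducedPhase v x u)) := by
    rw [← intervalIntegral.integral_const_mul]
    refine intervalIntegral.integral_congr fun θ hθ => ?_
    rw [Set.uIcc_of_le (by linarith)] at hθ
    have hθ' : ‖(θ : ℂ)‖ ≤ ρ := by
      rw [Complex.norm_real, Real.norm_eq_abs]
      linarith [abs_le.2 hθ]
    simp only [hf, hGdef]
    -- With μ = r/s the factor e^{isμθ} cancels e^{-irθ}; only the quadratic phase remains.
    rw [evalAt_polarPt_eq_exp hv ha hxv hρ hg hθ', mul_pow, ← Complex.exp_nat_mul, hmu]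
    have hsc : (s : ℂ) ≠ 0 := by exact_mod_cast hs.ne'
    have e : Complex.exp (-((s : ℝ) * (θ : ℂ) ^ 2 * reducedPhase v x θ)) =
        Complex.exp (s * (Complex.I * ((r : ℝ) / (s : ℝ) : ℝ) * θ - θ ^ 2 * reducedPhase v x θ)) *
          Complex.exp (-(Complex.I * r * θ)) := by
      rw [← Complex.exp_add]
      congr 1
      push_cast
      field_simp
      ring
    rw [e]; ring
  have hside : ∀ a b : ℝ, a ≤ b → b - a ≤ Real.pi → (∀ θ ∈ Set.Icc a b, ρ / 2 ≤ |θ| ∧ |θ| ≤ Real.pi) →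
      ‖∫ θ in a..b, f θ‖ ≤ P * (κ ^ s * evalAt v x ^ s) * Real.pi := by
    intro a b hab hba hab'
    have h := intervalIntegral.norm_integral_le_of_norm_le_const (a := a) (b := b) (f := f)
      (C := P * (κ ^ s * evalAt v x ^ s)) fun θ hθ => by
        rw [Set.uIoc_of_le hab] at hθ
        obtain ⟨h1, h2⟩ := hab' θ ⟨hθ.1.le, hθ.2⟩
        have h3 : ‖Complex.exp (-(Complex.I * r * θ))‖ = 1 := by
          rw [← Complex.norm_exp_ofReal_mul_I (-(r * θ))]
          congr 2; push_cast; ring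
        simp only [hf]
        rw [norm_mul, norm_mul, norm_pow, h3, mul_one, ← mul_pow]
        gcongr
        · exact hP x hx θ (abs_le.1 h2)
        · exact hκ x hx θ h1 h2
    refine h.trans ?_
    rw [abs_of_nonneg (by linarith)]
    gcongr
  have hs1 := hside (-Real.pi) (-(ρ / 2)) (by linarith) (by linarith) fun θ hθ => by
    rw [abs_of_neg (by linarith [hθ.2])]
    exact ⟨by linarith [hθ.2], by linarith [hθ.1]⟩
  have hs2 := hside (ρ / 2) Real.pi (by linarith) (by linarith) fun θ hθ => by
    rw [abs_of_pos (by linarith [hθ.1])]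
    exact hθ
  set E := (∫ θ in (-Real.pi)..(-(ρ / 2)), f θ) + ∫ θ in (ρ / 2)..Real.pi, f θ with hE
  have hEle : ‖E‖ ≤ evalAt v x ^ s * (2 * Real.pi * P * D * ((√s)⁻¹ * ((s : ℝ) ^ N)⁻¹)) := by
    calc ‖E‖ ≤ P * (κ ^ s * evalAt v x ^ s) * Real.pi + P * (κ ^ s * evalAt v x ^ s) * Real.pi :=
          (norm_add_le _ _).trans (add_le_add hs1 hs2)
      _ = evalAt v x ^ s * (2 * Real.pi * P * κ ^ s) := by ring
      _ ≤ evalAt v x ^ s * (2 * Real.pi * P * (D * ((√s)⁻¹ * ((s : ℝ) ^ N)⁻¹))) := by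
          gcongr; exact hD s hs
      _ = _ := by ring
  have hlap := norm_laplace_integral_sub_le hρ hG (differentiableOn_reducedPhase hv ha hxv hρ hg)
    hGC hqc hc N hs0
  rw [← hD₁] at hlap
  set I₀ := ∫ u in (-(ρ / 2))..(ρ / 2), G u *
        Complex.exp (-((s : ℝ) * (u : ℂ) ^ 2 * reducedPhase v x u)) with hI₀
  set S₀ := ∑ j ∈ Finset.range N, laplaceCoeff G (reducedPhase v x) j * (((s : ℝ) : ℂ) ^ j)⁻¹
    with hS₀
  have hsum : ∑ k ∈ Finset.range N, saddleCoeff v φ k x * ((s : ℂ) ^ k)⁻¹ =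
      (1 / (2 * Real.pi) : ℝ) * S₀ := by
    rw [hS₀, Finset.mul_sum]
    refine Finset.sum_congr rfl fun k _ => ?_
    rw [saddleCoeff, mul_assoc, Complex.ofReal_natCast]
  have hdecomp : coeff r (φ * cplx v ^ s) - (scale v x r s : ℂ) *
        ∑ k ∈ Finset.range N, saddleCoeff v φ k x * ((s : ℂ) ^ k)⁻¹ =
      ((1 / (2 * Real.pi) * x ^ (-(r : ℤ)) : ℝ) : ℂ) *
        ((evalAt v x ^ s : ℝ) * (I₀ - (√(s : ℝ))⁻¹ * S₀) + E) := by
    rw [coeff_mul_pow_eq_integral hφ hxv, integral_symm_split hfc (ρ / 2), ← hE, hmid, hsum,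
      scale_eq]
    push_cast
    ring
  rw [hdecomp, norm_mul, Complex.norm_real, Real.norm_of_nonneg (by positivity)]
  have hfin : ‖((evalAt v x ^ s : ℝ) : ℂ) * (I₀ - (√(s : ℝ))⁻¹ * S₀) + E‖ ≤
      evalAt v x ^ s * (D₁ * ((√s)⁻¹ * ((s : ℝ) ^ N)⁻¹)) +
      evalAt v x ^ s * (2 * Real.pi * P * D * ((√s)⁻¹ * ((s : ℝ) ^ N)⁻¹)) := by
    refine (norm_add_le _ _).trans (add_le_add ?_ hEle)
    rw [norm_mul, Complex.norm_real, Real.norm_of_nonneg (by positivity)]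
    gcongr
  refine (mul_le_mul_of_nonneg_left hfin (by positivity)).trans_eq ?_
  rw [scale_eq]
  ring

include hv ha in
theorem IsSaddle.eq {lam x y : ℝ} (hx : IsSaddle v lam x) (hy : IsSaddle v lam y) : x = y :=
  (strictMonoOn_mu hv ha).injOn ⟨hx.1, hx.2.1⟩ ⟨hy.1, hy.2.1⟩ (hx.2.2.trans hy.2.2.symm)

end Main

/-! ### Coefficients as functions of r/s, and the theorem. -/

open Classical in
/-- The `k`-th coefficient of the asymptotic expansion, as a function of `lam = μ(v; x)`. -/
def expansionCoeff (v : ℝ⟦X⟧) (φ : ℂ⟦X⟧) (k : ℕ) (lam : ℝ) : ℂ :=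
  if h : ∃ x, IsSaddle v lam x then saddleCoeff v φ k h.choose else 0

/-- Uniqueness of the saddle point makes the choice immaterial; the default 0 is used only where no
saddle point exists. -/
theorem expansionCoeff_eq {v : ℝ⟦X⟧} (hv : ∀ n, 0 ≤ coeff n v) (ha : IsAperiodic v) (φ : ℂ⟦X⟧)
    (k : ℕ) {lam x : ℝ} (hx : IsSaddle v lam x) :
    expansionCoeff v φ k lam = saddleCoeff v φ k x := by
  have h : ∃ x, IsSaddle v lam x := ⟨x, hx⟩
  rw [expansionCoeff, dif_pos h, IsSaddle.eq hv ha h.choose_spec hx]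

end RiordanAsymp

end

open RiordanAsymp in
theorem mainTheorem10 (v : PowerSeries ℝ) (φ : PowerSeries ℂ) (a : ℕ → ℕ → ℂ)
    (ha : RiordanAsymp.IsGeneralizedRiordanArray (PowerSeries.map Complex.ofRealHom v) φ a)
    (hv_pos : 0 < RiordanAsymp.convRadius v)
    (hv_aper : RiordanAsymp.IsAperiodic v)
    (hv_nonneg : ∀ n, 0 ≤ PowerSeries.coeff n v)
    (hφ : RiordanAsymp.convRadius v ≤ RiordanAsymp.convRadius φ) :
    ∃ (A : ℝ) (B : EReal),
      -- `A = μ(v; 0)` and `B = μ(v; R)` as one-sided limits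
      Tendsto (RiordanAsymp.mu v) (𝓝[>] 0) (𝓝 A) ∧
      Tendsto (fun x => (RiordanAsymp.mu v x : EReal))
        (RiordanAsymp.toLeftOf (RiordanAsymp.convRadius v)) (𝓝 B) ∧
      -- unique positive solution of `μ(v; x) = lam` for `A < lam < B`
      (∀ lam : ℝ, A < lam → (lam : EReal) < B → ∃! x : ℝ, RiordanAsymp.IsSaddle v lam x) ∧
      (∃ b : ℕ → ℝ → ℂ,
        -- the leading coefficient
        (∀ lam x : ℝ, A < lam → (lam : EReal) < B → RiordanAsymp.IsSaddle v lam x →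
          0 < RiordanAsymp.sigmaSq v x ∧
          b 0 lam = RiordanAsymp.evalAt φ (x : ℂ) /
            ((Real.sqrt (2 * Real.pi * RiordanAsymp.sigmaSq v x) : ℝ) : ℂ) ∧
          (b 0 lam ≠ 0 ↔ RiordanAsymp.evalAt φ (x : ℂ) ≠ 0)) ∧
        -- the asymptotic expansion, uniform for `r / s` in a compact subset of `(A, B)`
        (∀ K : Set ℝ, IsCompact K → (∀ lam ∈ K, A < lam ∧ (lam : EReal) < B) →
          ∀ N : ℕ, ∃ M : ℝ, ∀ (r s : ℕ) (x : ℝ), 0 < s → (r : ℝ) / (s : ℝ) ∈ K →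
            RiordanAsymp.IsSaddle v ((r : ℝ) / (s : ℝ)) x →
            ‖a r s - (RiordanAsymp.scale v x r s : ℂ) *
                ∑ k ∈ Finset.range N, b k ((r : ℝ) / (s : ℝ)) * ((s : ℂ) ^ k)⁻¹‖ ≤
              M * RiordanAsymp.scale v x r s * ((s : ℝ) ^ N)⁻¹)) ∧
      (∀ r s : ℕ, 0 < s → (r : ℝ) / (s : ℝ) < A → a r s = 0) := by
  obtain ⟨p, m, hp, -, -, hlt⟩ := hv_aper.exists_order
  have hA := tendsto_mu_zero hv_nonneg hv_aper hv_pos hp hlt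
  have hex := fun lam h1 h2 => exists_saddle hv_nonneg hv_aper (lam := lam) hA h1 h2
  have hmono := strictMonoOn_mu hv_nonneg hv_aper
  -- A is the order of v, and B is the supremum of the increasing mean.
  refine ⟨p, ⨆ x ∈ posDisc v, (mu v x : EReal), hA, tendsto_mu_toLeftOf hv_nonneg hv_aper,
    fun lam h1 h2 => ?_, ⟨expansionCoeff v φ, ?_, ?_⟩, ?_⟩
  · obtain ⟨x, hx, hxl⟩ := hex lam h1 h2
    exact ⟨x, ⟨hx.1, hx.2, hxl⟩, fun y hy => IsSaddle.eq hv_nonneg hv_aper hy ⟨hx.1, hx.2, hxl⟩⟩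
  · intro lam x _ _ hx
    have hxv : x ∈ posDisc v := ⟨hx.1, hx.2.1⟩
    have hσ := sigmaSq_pos hv_nonneg hv_aper hxv
    have hb : expansionCoeff v φ 0 lam =
        evalAt φ (x : ℂ) / ((Real.sqrt (2 * Real.pi * sigmaSq v x) : ℝ) : ℂ) :=
      (expansionCoeff_eq hv_nonneg hv_aper φ 0 hx).trans (saddleCoeff_zero hv_nonneg hv_aper φ hxv)
    have hsq : ((Real.sqrt (2 * Real.pi * sigmaSq v x) : ℝ) : ℂ) ≠ 0 := by
      have := Real.pi_pos
      exact_mod_cast (Real.sqrt_pos.2 (by positivity)).ne'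
    refine ⟨hσ, hb, ?_⟩
    rw [hb, div_ne_zero_iff]
    exact and_iff_left hsq
  · intro K hK hKAB N
    rcases K.eq_empty_or_nonempty with hK0 | hK0
    · exact ⟨0, fun r s x _ h => by simp [hK0] at h⟩
    -- By monotonicity of μ, every saddle point for a value in K lies between those of min K and max
    -- K, a compact interval inside (0, R).
    obtain ⟨l₁, hl₁, hmin⟩ := hK.exists_isLeast hK0
    obtain ⟨l₂, hl₂, hmax⟩ := hK.exists_isGreatest hK0
    obtain ⟨x₁, hx₁, hx₁l⟩ := hex l₁ (hKAB l₁ hl₁).1 (hKAB l₁ hl₁).2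
    obtain ⟨x₂, hx₂, hx₂l⟩ := hex l₂ (hKAB l₂ hl₂).1 (hKAB l₂ hl₂).2
    obtain ⟨M, hM⟩ := exists_uniform_expansion_bound hv_nonneg hv_aper hφ
      (isCompact_Icc (a := x₁) (b := x₂)) ((ordConnected_posDisc v).out hx₁ hx₂) N
    refine ⟨M, fun r s x hs hrs hx => ?_⟩
    have hxv : x ∈ posDisc v := ⟨hx.1, hx.2.1⟩
    have hxJ : x ∈ Set.Icc x₁ x₂ := by
      constructor
      · rw [← hmono.le_iff_le hx₁ hxv, hx₁l, hx.2.2]; exact hmin hrs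
      · rw [← hmono.le_iff_le hxv hx₂, hx₂l, hx.2.2]; exact hmax hrs
    simp only [expansionCoeff_eq hv_nonneg hv_aper φ _ hx]
    rw [riordan_coeff ha]
    exact hM x hxJ r s hs hx.2.2
  · intro r s hs hrs
    rw [riordan_coeff ha]
    refine coeff_mul_pow_eq_zero (p := p) (fun n hn => by simp [hlt n hn]) ?_
    rw [div_lt_iff₀ (by exact_mod_cast hs)] at hrs
    exact_mod_cast hrs
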